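/- For real $a,b$ let $T_{ab}:\mathbb R^2\to\mathbb R^2$ be the piecewise-linear map $T_{ab}(x,y)=(ax-y,x)$ if $x\ge 0$ and $T_{ab}(x,y)=(bx-y,x)$ if $x<0$, and let $S_{ab}$ be the induced map $u\mapsto T_{ab}(u)/|T_{ab}(u)|$ of the unit circle. Let $r(S_{ab})\in[0,1)$ denote its (counterclockwise) rotation number: the number $\lim_{n\to\infty} F^n(t)/n$ modulo $1$, where $F:\mathbb R\to\mathbb R$ is a continuous nondecreasing lift of $S_{ab}$, the circle being parametrized by $t\mapsto(\cos 2\pi t,\sin 2\pi t)$. An invariant circle of $T_{ab}$ is a simple closed curve $C$ enclosing the origin with $T_{ab}(C)=C$; it is composed of $n$ arcs of ellipses if it can be cut into $n$ consecutive arcs, each of which lies on an ellipse centred at the origin (different arcs may lie on the same ellipse). (A) Let $1<a<\sqrt 2$ and $b=\dfrac{2(a^2-1)}{a(a^2-2)}$. Then: 1. $b<0$ and $T_{ab}^{(8)}(0,-1)=(0,1)$. 2. Writing $a=2\cos\theta$ with $\pi/4<\theta<\pi/3$, one has $$r(S_{ab})=\frac{3\pi-7\theta}{14\pi-32\theta},$$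 and $r(S_{ab})$ is rational if and only if $\theta$ is a rational multiple of $\pi$. 3. If $r(S_{ab})$ is rational, then $T_{ab}$ is periodic, i.e. $T_{ab}^{(k)}$ is the identity for some $k\ge1$. If $r(S_{ab})$ is irrational, then $T_{ab}$ has an invariant circle composed of at most $8$ arcs of ellipses. In particular $T_{ab}$ is either periodic or has such an invariant circle. (B) For $a=2^{1/4}$, $b=-2^{1/4}$ the rotation number $r(S_{ab})$ is irrational, and $T_{ab}$ has an invariant circle composed of $8$ arcs of ellipses. -/

import Mathlib

/-- The piecewise-linear map `T_{ab}` of the plane: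
`(x, y) ↦ (a x - y, x)` if `x ≥ 0` and `(x, y) ↦ (b x - y, x)` if `x < 0`. -/
noncomputable def planeMap (a b : ℝ) (p : ℝ × ℝ) : ℝ × ℝ :=
  if 0 ≤ p.1 then (a * p.1 - p.2, p.1) else (b * p.1 - p.2, p.1)

/-- The point of the unit circle at angle `2 π t`. -/
noncomputable def circlePoint (t : ℝ) : ℝ × ℝ :=
  (Real.cos (2 * Real.pi * t), Real.sin (2 * Real.pi * t))

/-- Radial projection of a nonzero vector to the Euclidean unit circle. -/
noncomputable def radialProj (p : ℝ × ℝ) : ℝ × ℝ :=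
  (p.1 / Real.sqrt (p.1 ^ 2 + p.2 ^ 2), p.2 / Real.sqrt (p.1 ^ 2 + p.2 ^ 2))

/-- The rotation map `S_{ab}(u) = T_{ab}(u) / |T_{ab}(u)|` (used on the unit circle only). -/
noncomputable def rotationMap (a b : ℝ) (u : ℝ × ℝ) : ℝ × ℝ :=
  radialProj (planeMap a b u)

/-- `F` is a continuous lift to the universal cover `ℝ` (circle of length one, counterclockwise)
of the self-map `f` of the unit circle.  Elements of `CircleDeg1Lift` are monotone and satisfy
`F (t + 1) = F t + 1`. -/
def IsCircleLift (f : ℝ × ℝ → ℝ × ℝ) (F : CircleDeg1Lift) : Prop :=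
  Continuous F ∧ ∀ t : ℝ, f (circlePoint t) = circlePoint (F t)

open Classical in
/-- The (counterclockwise) rotation number, normalised to `[0, 1)`, of a circle map: the
translation number `lim F^n(t) / n` modulo one of a lift `F`.  It does not depend on the lift
(`rotationNumber_eq` below).  The value for maps without a lift is `0`. -/
noncomputable def rotationNumber (f : ℝ × ℝ → ℝ × ℝ) : ℝ :=
  if h : ∃ F : CircleDeg1Lift, IsCircleLift f F then
    Int.fract (CircleDeg1Lift.translationNumber h.choose) else 0

theorem circlePoint_eq_iff (s t : ℝ) :
    circlePoint s = circlePoint t ↔ ∃ m : ℤ, s = t + m := by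
  have hpi : (2 * Real.pi) ≠ 0 := by positivity
  constructor
  · intro h
    have h1 : Real.cos (2 * Real.pi * s) = Real.cos (2 * Real.pi * t) := congrArg Prod.fst h
    have h2 : Real.sin (2 * Real.pi * s) = Real.sin (2 * Real.pi * t) := congrArg Prod.snd h
    have h3 : Real.cos (2 * Real.pi * s - 2 * Real.pi * t) = 1 := by
      rw [Real.cos_sub, h1, h2, ← sq, ← sq]
      exact Real.cos_sq_add_sin_sq _
    obtain ⟨m, hm⟩ := (Real.cos_eq_one_iff _).1 h3
    refine ⟨m, mul_left_cancel₀ hpi ?_⟩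
    linarith
  · rintro ⟨m, rfl⟩
    have e : 2 * Real.pi * (t + m) = 2 * Real.pi * t + m * (2 * Real.pi) := by ring
    simp only [circlePoint, e, Real.cos_add_int_mul_two_pi, Real.sin_add_int_mul_two_pi]

/-- The rotation number can be computed from any continuous lift. -/
theorem rotationNumber_eq {f : ℝ × ℝ → ℝ × ℝ} {F : CircleDeg1Lift} (hF : IsCircleLift f F) :
    rotationNumber f = Int.fract (CircleDeg1Lift.translationNumber F) := by
  have h : ∃ F : CircleDeg1Lift, IsCircleLift f F := ⟨F, hF⟩
  rw [rotationNumber, dif_pos h]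
  obtain ⟨hGc, hG⟩ := h.choose_spec
  obtain ⟨hFc, hFl⟩ := hF
  generalize h.choose = G at hGc hG
  have key : ∀ t, ∃ m : ℤ, G t = F t + m := fun t =>
    (circlePoint_eq_iff _ _).1 ((hG t).symm.trans (hFl t))
  choose m hm using key
  have hmc : Continuous m := by
    rw [Int.isClosedEmbedding_coe_real.isEmbedding.continuous_iff]
    have : ((fun n : ℤ => (n : ℝ)) ∘ m) = fun t => G t - F t := by
      funext t
      simp [hm t]
    rw [this]
    exact hGc.sub hFc
  have hconst : ∀ t, m t = m 0 := fun t => PreconnectedSpace.constant inferInstance hmc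
  have hGF : G = (CircleDeg1Lift.translate (Multiplicative.ofAdd (m 0 : ℝ)) : CircleDeg1Lift) * F := by
    ext t
    rw [CircleDeg1Lift.mul_apply, CircleDeg1Lift.translate_apply, hm t, hconst t, add_comm]
  have hcomm : Commute
      (CircleDeg1Lift.translate (Multiplicative.ofAdd (m 0 : ℝ)) : CircleDeg1Lift) F := by
    ext t
    simp [CircleDeg1Lift.mul_apply, CircleDeg1Lift.translate_apply]
  rw [hGF, CircleDeg1Lift.translationNumber_mul_of_commute hcomm,
    CircleDeg1Lift.translationNumber_translate, Int.fract_intCast_add]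

/-- A self-map is periodic (of finite order): some positive iterate is the identity. -/
def IsPeriodicMap (f : ℝ × ℝ → ℝ × ℝ) : Prop := ∃ k : ℕ, 1 ≤ k ∧ f^[k] = id

/-- `γ` is a parametrisation, of period one, of the simple closed curve `C` in the plane. -/
def ParametrizesClosedCurve (γ : ℝ → ℝ × ℝ) (C : Set (ℝ × ℝ)) : Prop :=
  Continuous γ ∧ Function.Periodic γ 1 ∧ Set.InjOn γ (Set.Ico 0 1) ∧ Set.range γ = C

/-- An invariant circle of `f`: a simple closed curve `C` enclosing the origin (the origin lies in
a bounded component of the complement of `C`) such that `f(C) = C`. -/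
def IsInvariantCircle (f : ℝ × ℝ → ℝ × ℝ) (C : Set (ℝ × ℝ)) : Prop :=
  (∃ γ : ℝ → ℝ × ℝ, ParametrizesClosedCurve γ C) ∧
    (0 : ℝ × ℝ) ∉ C ∧
    Bornology.IsBounded (connectedComponentIn Cᶜ (0 : ℝ × ℝ)) ∧
    f '' C = C

/-- Ellipses centred at the origin: level sets `A x² + B x y + C y² = 1` of a positive definite
quadratic form. -/
def IsCentredEllipse (E : Set (ℝ × ℝ)) : Prop :=
  ∃ A B C : ℝ, 0 < A ∧ 0 < 4 * A * C - B ^ 2 ∧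
    E = {p | A * p.1 ^ 2 + B * (p.1 * p.2) + C * p.2 ^ 2 = 1}

/-- The simple closed curve `C` is composed of `n` consecutive arcs of ellipses: there are a
parametrisation and breakpoints `0 = t 0 < t 1 < ⋯ < t n = 1` such that each of the `n` pieces of
the curve lies on an ellipse. -/
def IsPiecewiseElliptic (n : ℕ) (C : Set (ℝ × ℝ)) : Prop :=
  ∃ (γ : ℝ → ℝ × ℝ) (t : Fin (n + 1) → ℝ),
    ParametrizesClosedCurve γ C ∧ StrictMono t ∧ t 0 = 0 ∧ t (Fin.last n) = 1 ∧
    ∀ i : Fin n, ∃ E : Set (ℝ × ℝ), IsCentredEllipse E ∧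
      γ '' Set.Icc (t i.castSucc) (t i.succ) ⊆ E

/-! On the right half-plane the map T is linear with trace a = 2 cos θ and determinant 1. It
preserves the ellipse x² − a x y + y² = 1 and advances its parameter (`ellipsePoint`) by θ. Put p_j
= T^j(0, −1). The relation between a and b makes p_5 the mirror image of p_4 under the swap of
coordinates, so p_4, p_0, p_5 and p_9 = (−1, 0) all lie on this one ellipse.

Take the arc J of the ellipse from p_4 through p_0 to p_5 = T p_4. It splits at p_0 into a left part
of length α = 2π − 4θ and a right part of length β = π − 3θ, so its length is ω = α + β = 3π − 7θ.
An elliptic arc is determined linearly by its endpoints and its angular length, and T is linear on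
it while both endpoints lie on the same side of the axis. The images of the two parts are therefore
again arcs of lengths α and β, and consecutive images of J fit end to end through p_4, p_0, p_5,
p_1, p_6, p_2, p_7, p_3, p_8, p_4. T⁴ carries the β-part and T⁵ the α-part back onto the two pieces
of J cut at p_9, with matching parameters, so the chain closes up after length L = 4ω + α = 14π −
32θ (`invariantCurve_add_length`).

On this closed curve T is translation by ω modulo L. T preserves oriented area on each half-plane,
so the polar angle increases strictly along the curve; the visits to the vertical axis show that it
winds once around the origin. Radial projection then conjugates the circle map to a rotation by ω/L,
which is the rotation number. If ω/L is rational, some iterate of T fixes the curve pointwise, hence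
the plane by homogeneity. J lies on a single ellipse, which leaves eight elliptic arcs.

For a = 2^{1/4} one finds cos 4θ = 2 − 2√2. Its conjugate 2 + 2√2 exceeds 1, so 4θ cannot be a
rational multiple of 2π (`not_rational_angle_of_cos_eq`). -/

section InvariantCircle

open Real

/-! ### The plane map on half-planes -/

theorem planeMap_of_nonneg {a b : ℝ} {p : ℝ × ℝ} (h : 0 ≤ p.1) :
    planeMap a b p = (a * p.1 - p.2, p.1) := if_pos h

/-- The two branches agree on the vertical axis, so boundary points may be assigned to either
half-plane. -/
theorem planeMap_of_nonpos {a b : ℝ} {p : ℝ × ℝ} (h : p.1 ≤ 0) :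
    planeMap a b p = (b * p.1 - p.2, p.1) := by
  rcases h.lt_or_eq with h | h
  · exact if_neg h.not_ge
  · simp [planeMap, h]

theorem planeMap_smul {a b c : ℝ} (hc : 0 ≤ c) (p : ℝ × ℝ) :
    planeMap a b (c • p) = c • planeMap a b p := by
  rcases le_total 0 p.1 with h | h
  · rw [planeMap_of_nonneg h, planeMap_of_nonneg (by simpa using mul_nonneg hc h)]
    ext <;> simp; ring
  · rw [planeMap_of_nonpos h,
      planeMap_of_nonpos (by simpa using mul_nonpos_of_nonneg_of_nonpos hc h)]
    ext <;> simp; ring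

theorem planeMap_zero (a b : ℝ) : planeMap a b 0 = 0 := by
  simp [planeMap]

/-- `p` and `q` lie in a common closed half-plane bounded by the vertical axis. -/
def SameSide (p q : ℝ × ℝ) : Prop := (0 ≤ p.1 ∧ 0 ≤ q.1) ∨ (p.1 ≤ 0 ∧ q.1 ≤ 0)

/-- A closed half-plane is a convex cone, so nonnegative combinations stay on one linear branch. -/
theorem planeMap_combo {a b c d : ℝ} {p q : ℝ × ℝ} (h : SameSide p q) (hc : 0 ≤ c) (hd : 0 ≤ d) :
    planeMap a b (c • p + d • q) = c • planeMap a b p + d • planeMap a b q := by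
  rcases h with ⟨hp, hq⟩ | ⟨hp, hq⟩
  · rw [planeMap_of_nonneg hp, planeMap_of_nonneg hq, planeMap_of_nonneg]
    · ext <;> simp; ring
    · simp only [Prod.fst_add, Prod.smul_fst, smul_eq_mul]; positivity
  · rw [planeMap_of_nonpos hp, planeMap_of_nonpos hq, planeMap_of_nonpos]
    · ext <;> simp; ring
    · simp only [Prod.fst_add, Prod.smul_fst, smul_eq_mul]
      exact add_nonpos (mul_nonpos_of_nonneg_of_nonpos hc hp)
        (mul_nonpos_of_nonneg_of_nonpos hd hq)

/-- The inverse of the plane map. -/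
noncomputable def planeMapInv (a b : ℝ) (p : ℝ × ℝ) : ℝ × ℝ :=
  if 0 ≤ p.2 then (p.2, a * p.2 - p.1) else (p.2, b * p.2 - p.1)

/-- The plane map as a bijection of the plane. -/
noncomputable def planeEquiv (a b : ℝ) : Equiv.Perm (ℝ × ℝ) where
  toFun := planeMap a b
  invFun := planeMapInv a b
  left_inv p := by
    by_cases h : 0 ≤ p.1 <;> simp [planeMap, planeMapInv, h]
  right_inv p := by
    by_cases h : 0 ≤ p.2 <;> simp [planeMap, planeMapInv, h]

theorem planeEquiv_apply (a b : ℝ) (p : ℝ × ℝ) : planeEquiv a b p = planeMap a b p := rfl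

theorem continuous_planeMap (a b : ℝ) : Continuous (planeMap a b) := by
  refine Continuous.if_le (by fun_prop) (by fun_prop) continuous_const continuous_fst ?_
  intro p hp
  simp [← hp]

theorem continuous_planeMapInv (a b : ℝ) : Continuous (planeMapInv a b) := by
  refine Continuous.if_le (by fun_prop) (by fun_prop) continuous_const continuous_snd ?_
  intro p hp
  simp [← hp]

theorem continuous_planeEquiv_zpow (a b : ℝ) (n : ℤ) : Continuous ⇑(planeEquiv a b ^ n) := by
  cases n with
  | ofNat n =>
    rw [Int.ofNat_eq_natCast, zpow_natCast, Equiv.Perm.coe_pow]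
    exact (continuous_planeMap a b).iterate n
  | negSucc n =>
    rw [zpow_negSucc, ← inv_pow, Equiv.Perm.coe_pow]
    exact (continuous_planeMapInv a b).iterate _

/-! ### Elliptic arcs -/

/-- The arc from `p` to `q`, of angular length `l`, of the ellipse centred at the origin that is
the affine image of a circle. -/
noncomputable def arc (l : ℝ) (p q : ℝ × ℝ) (s : ℝ) : ℝ × ℝ :=
  (sin (l - s) / sin l) • p + (sin s / sin l) • q

theorem planeMap_arc {a b l s : ℝ} {p q : ℝ × ℝ} (h : SameSide p q) (hl : l < π)
    (hs : s ∈ Set.Icc 0 l) :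
    planeMap a b (arc l p q s) = arc l (planeMap a b p) (planeMap a b q) s := by
  obtain ⟨h0, h1⟩ := hs
  exact planeMap_combo h
    (div_nonneg (sin_nonneg_of_nonneg_of_le_pi (by linarith) (by linarith))
      (sin_nonneg_of_nonneg_of_le_pi (by linarith) (by linarith)))
    (div_nonneg (sin_nonneg_of_nonneg_of_le_pi (by linarith) (by linarith))
      (sin_nonneg_of_nonneg_of_le_pi (by linarith) (by linarith)))

theorem arc_zero {l : ℝ} (hl : sin l ≠ 0) (p q : ℝ × ℝ) : arc l p q 0 = p := by
  simp [arc, hl]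

theorem arc_fst_nonneg {l s : ℝ} {p q : ℝ × ℝ} (hp : 0 ≤ p.1) (hq : 0 ≤ q.1) (hl : l < π)
    (hs : s ∈ Set.Icc 0 l) : 0 ≤ (arc l p q s).1 := by
  obtain ⟨h0, h1⟩ := hs
  have h2 : 0 ≤ sin (l - s) := sin_nonneg_of_nonneg_of_le_pi (by linarith) (by linarith)
  have h3 : 0 ≤ sin s := sin_nonneg_of_nonneg_of_le_pi (by linarith) (by linarith)
  have h4 : 0 ≤ sin l := sin_nonneg_of_nonneg_of_le_pi (by linarith) (by linarith)
  simp only [arc, Prod.fst_add, Prod.smul_fst, smul_eq_mul]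
  positivity

theorem arc_neg (l : ℝ) (p q : ℝ × ℝ) (s : ℝ) : arc l (-p) (-q) s = -arc l p q s := by
  simp only [arc, smul_neg]; abel

theorem arc_fst_nonpos {l s : ℝ} {p q : ℝ × ℝ} (hp : p.1 ≤ 0) (hq : q.1 ≤ 0) (hl : l < π)
    (hs : s ∈ Set.Icc 0 l) : (arc l p q s).1 ≤ 0 := by
  have := arc_fst_nonneg (p := -p) (q := -q) (by simpa using hp) (by simpa using hq) hl hs
  rw [arc_neg] at this
  simpa using this

/-- Oriented area spanned by two vectors. -/
def wedge (p q : ℝ × ℝ) : ℝ := p.1 * q.2 - p.2 * q.1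

/-- Both linear branches have determinant 1. -/
theorem wedge_planeMap {a b : ℝ} {p q : ℝ × ℝ} (h : SameSide p q) :
    wedge (planeMap a b p) (planeMap a b q) = wedge p q := by
  rcases h with ⟨hp, hq⟩ | ⟨hp, hq⟩
  · rw [planeMap_of_nonneg hp, planeMap_of_nonneg hq]; simp only [wedge]; ring
  · rw [planeMap_of_nonpos hp, planeMap_of_nonpos hq]; simp only [wedge]; ring

theorem wedge_arc {l : ℝ} (hl : sin l ≠ 0) (p q : ℝ × ℝ) (s t : ℝ) :
    wedge (arc l p q s) (arc l p q t) = wedge p q * sin (t - s) / sin l := by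
  have key : sin (l - s) * sin t - sin s * sin (l - t) = sin l * sin (t - s) := by
    simp only [sin_sub]; ring
  simp only [wedge, arc, Prod.fst_add, Prod.snd_add, Prod.smul_fst, Prod.smul_snd, smul_eq_mul]
  field_simp
  linear_combination (p.1 * q.2 - p.2 * q.1) * key

/-- A nondegenerate arc lies on an ellipse centred at the origin. -/
theorem exists_isCentredEllipse_arc {l : ℝ} {p q : ℝ × ℝ} (hl : 0 < sin l)
    (hpq : wedge p q ≠ 0) : ∃ E, IsCentredEllipse E ∧ ∀ s, arc l p q s ∈ E := by
  have hc : cos l ^ 2 < 1 := by nlinarith [sin_sq_add_cos_sq l]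
  have hlq : ∀ x y : ℝ, (x ≠ 0 ∨ y ≠ 0) → 0 < x ^ 2 + y ^ 2 - 2 * cos l * x * y := by
    intro x y h
    have e : x ^ 2 + y ^ 2 - 2 * cos l * x * y = (x - cos l * y) ^ 2 + (1 - cos l ^ 2) * y ^ 2 := by
      ring
    rw [e]
    by_cases hy : y = 0
    · have : x ≠ 0 := by tauto
      subst hy; simp; positivity
    · have : 0 < (1 - cos l ^ 2) * y ^ 2 := mul_pos (by linarith) (by positivity)
      positivity
  set D := wedge p q with hD
  have hD' : D = p.1 * q.2 - p.2 * q.1 := rfl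
  -- In the basis p, q the arc has coordinates x = sin (l − s) / sin l and y = sin s / sin l, which
  -- satisfy x² + y² + 2 cos l · x y = 1. Substituting x = `wedge r q / D` and y = `wedge p r / D`
  -- gives these coefficients.
  refine ⟨{r | ((q.2 ^ 2 + p.2 ^ 2 - 2 * cos l * q.2 * p.2) / D ^ 2) * r.1 ^ 2 +
      ((-2 * q.1 * q.2 - 2 * p.1 * p.2 + 2 * cos l * (q.2 * p.1 + q.1 * p.2)) / D ^ 2) *
        (r.1 * r.2) + ((q.1 ^ 2 + p.1 ^ 2 - 2 * cos l * q.1 * p.1) / D ^ 2) * r.2 ^ 2 = 1},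
    ⟨_, _, _, ?_, ?_, rfl⟩, ?_⟩
  · refine div_pos (hlq _ _ ?_) (by positivity)
    by_contra! h
    exact hpq (by rw [hD', h.1, h.2]; ring)
  · have e : 4 * ((q.2 ^ 2 + p.2 ^ 2 - 2 * cos l * q.2 * p.2) / D ^ 2) *
        ((q.1 ^ 2 + p.1 ^ 2 - 2 * cos l * q.1 * p.1) / D ^ 2) -
        ((-2 * q.1 * q.2 - 2 * p.1 * p.2 + 2 * cos l * (q.2 * p.1 + q.1 * p.2)) / D ^ 2) ^ 2 =
        4 * (1 - cos l ^ 2) / D ^ 2 := by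
      field_simp
      rw [hD']
      ring
    rw [e]
    exact div_pos (by linarith) (by positivity)
  · intro s
    have h1 : sin (l - s) = sin l * cos s - cos l * sin s := sin_sub _ _
    have h2 : sin (l - s) ^ 2 + sin s ^ 2 + 2 * cos l * sin (l - s) * sin s = sin l ^ 2 := by
      rw [h1]
      linear_combination sin l ^ 2 * sin_sq_add_cos_sq s - sin s ^ 2 * sin_sq_add_cos_sq l
    simp only [Set.mem_ofPred_eq, arc, Prod.fst_add, Prod.snd_add, Prod.smul_fst, Prod.smul_snd,
      smul_eq_mul]
    field_simp
    rw [hD']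
    linear_combination (p.1 * q.2 - p.2 * q.1) ^ 2 * h2

/-! ### Resonant parameters and the critical orbit -/

/-- Parameters for which the orbit of `(0, -1)` returns to the vertical axis after eight steps. -/
structure IsResonant (a b θ : ℝ) : Prop where
  lower : π / 4 < θ
  upper : θ < π / 3
  a_eq : a = 2 * cos θ
  b_eq : b * (a * (a ^ 2 - 2)) = 2 * (a ^ 2 - 1)

namespace IsResonant

variable {a b θ : ℝ}

theorem sin_pos (h : IsResonant a b θ) : 0 < sin θ :=
  sin_pos_of_pos_of_lt_pi (by linarith [h.lower, pi_pos]) (by linarith [h.upper, pi_pos])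

theorem one_lt_a (h : IsResonant a b θ) : 1 < a := by
  have : cos (π / 3) < cos θ :=
    cos_lt_cos_of_nonneg_of_le_pi (by linarith [h.lower, pi_pos]) (by linarith [pi_pos]) h.upper
  rw [cos_pi_div_three] at this
  linarith [h.a_eq]

theorem a_sq_lt_two (h : IsResonant a b θ) : a ^ 2 < 2 := by
  have h1 : cos (2 * θ) < cos (π / 2) :=
    cos_lt_cos_of_nonneg_of_le_pi (by linarith [pi_pos]) (by linarith [h.upper, pi_pos])
      (by linarith [h.lower])
  rw [cos_pi_div_two, cos_two_mul] at h1
  rw [h.a_eq]; linarith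

theorem x4_neg (h : IsResonant a b θ) : a ^ 3 - 2 * a < 0 := by
  nlinarith [h.one_lt_a, h.a_sq_lt_two]

theorem x3_pos (h : IsResonant a b θ) : 0 < a ^ 2 - 1 := by
  nlinarith [h.one_lt_a]

theorem b_neg (h : IsResonant a b θ) : b < 0 := by
  by_contra! hb
  nlinarith [h.b_eq, h.x4_neg, h.x3_pos]

/-- α = 2π − 4θ is the parameter length of the ellipse arc from the fourth orbit point to (0, −1); β
= π − 3θ below is that from (0, −1) to the fifth. -/
theorem sin_alpha_pos (h : IsResonant a b θ) : 0 < sin (2 * π - 4 * θ) :=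
  sin_pos_of_pos_of_lt_pi (by linarith [h.upper, pi_pos]) (by linarith [h.lower])

theorem sin_beta_pos (h : IsResonant a b θ) : 0 < sin (π - 3 * θ) :=
  sin_pos_of_pos_of_lt_pi (by linarith [h.upper]) (by linarith [h.lower, pi_pos])

theorem step_pos (h : IsResonant a b θ) : 0 < 3 * π - 7 * θ := by
  linarith [h.upper, pi_pos]

theorem length_pos (h : IsResonant a b θ) : 0 < 14 * π - 32 * θ := by
  linarith [h.upper, pi_pos]

end IsResonant

/-- The orbit of `(0, -1)` under the plane map. -/
noncomputable def criticalOrbit (a b : ℝ) (j : ℕ) : ℝ × ℝ := (planeMap a b)^[j] (0, -1)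

theorem planeMap_criticalOrbit (a b : ℝ) (j : ℕ) :
    planeMap a b (criticalOrbit a b j) = criticalOrbit a b (j + 1) :=
  (Function.iterate_succ_apply' _ _ _).symm

section orbit

variable {a b θ : ℝ}

theorem criticalOrbit_zero : criticalOrbit a b 0 = (0, -1) := rfl

theorem criticalOrbit_one : criticalOrbit a b 1 = (1, 0) := by
  rw [← planeMap_criticalOrbit, criticalOrbit_zero, planeMap_of_nonneg le_rfl]
  simp

theorem criticalOrbit_two : criticalOrbit a b 2 = (a, 1) := by
  rw [← planeMap_criticalOrbit, criticalOrbit_one, planeMap_of_nonneg zero_le_one]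
  simp

theorem criticalOrbit_three (h : IsResonant a b θ) : criticalOrbit a b 3 = (a ^ 2 - 1, a) := by
  rw [← planeMap_criticalOrbit, criticalOrbit_two, planeMap_of_nonneg (by linarith [h.one_lt_a])]
  ext <;> simp; ring

theorem criticalOrbit_four (h : IsResonant a b θ) :
    criticalOrbit a b 4 = (a ^ 3 - 2 * a, a ^ 2 - 1) := by
  rw [← planeMap_criticalOrbit, criticalOrbit_three h, planeMap_of_nonneg h.x3_pos.le]
  ext <;> simp; ring

/-- This is where the resonance enters. The swap of coordinates conjugates T to its inverse, so once
the fifth point is the swap of the fourth, the rest of the orbit mirrors its beginning. -/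
theorem criticalOrbit_five (h : IsResonant a b θ) :
    criticalOrbit a b 5 = (a ^ 2 - 1, a ^ 3 - 2 * a) := by
  rw [← planeMap_criticalOrbit, criticalOrbit_four h, planeMap_of_nonpos h.x4_neg.le]
  ext <;> simp
  linear_combination h.b_eq

theorem criticalOrbit_six (h : IsResonant a b θ) : criticalOrbit a b 6 = (a, a ^ 2 - 1) := by
  rw [← planeMap_criticalOrbit, criticalOrbit_five h, planeMap_of_nonneg h.x3_pos.le]
  ext <;> simp; ring

theorem criticalOrbit_seven (h : IsResonant a b θ) : criticalOrbit a b 7 = (1, a) := by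
  rw [← planeMap_criticalOrbit, criticalOrbit_six h, planeMap_of_nonneg (by linarith [h.one_lt_a])]
  ext <;> simp; ring

theorem criticalOrbit_eight (h : IsResonant a b θ) : criticalOrbit a b 8 = (0, 1) := by
  rw [← planeMap_criticalOrbit, criticalOrbit_seven h, planeMap_of_nonneg zero_le_one]
  ext <;> simp

theorem criticalOrbit_nine (h : IsResonant a b θ) : criticalOrbit a b 9 = (-1, 0) := by
  rw [← planeMap_criticalOrbit, criticalOrbit_eight h, planeMap_of_nonneg le_rfl]
  ext <;> simp

theorem criticalOrbit_fst_nonneg (h : IsResonant a b θ) {j : ℕ} (hj : j ≤ 8) (h4 : j ≠ 4) :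
    0 ≤ (criticalOrbit a b j).1 := by
  have ha := h.one_lt_a
  have hx := h.x3_pos
  interval_cases j
  all_goals
    first
    | exact absurd rfl h4
    | (simp only [criticalOrbit_zero, criticalOrbit_one, criticalOrbit_two, criticalOrbit_three h,
        criticalOrbit_five h, criticalOrbit_six h, criticalOrbit_seven h, criticalOrbit_eight h]
       linarith)

/-- Among the points 0 to 8 only the fourth is strictly to the left of the axis, and its partners 0
and 8 lie on the axis. -/
theorem sameSide_criticalOrbit_four (h : IsResonant a b θ) {j : ℕ} (hj : j ≤ 4) :
    SameSide (criticalOrbit a b (j + 4)) (criticalOrbit a b j) := by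
  by_cases h0 : j = 0
  · subst h0; right; simp [criticalOrbit_zero, criticalOrbit_four h, h.x4_neg.le]
  by_cases h4 : j = 4
  · subst h4; right; simp [criticalOrbit_eight h, criticalOrbit_four h, h.x4_neg.le]
  · left
    exact ⟨criticalOrbit_fst_nonneg h (by omega) (by omega),
      criticalOrbit_fst_nonneg h (by omega) (by omega)⟩

theorem sameSide_criticalOrbit_five (h : IsResonant a b θ) {j : ℕ} (hj : j ≤ 3) :
    SameSide (criticalOrbit a b j) (criticalOrbit a b (j + 5)) :=
  .inl ⟨criticalOrbit_fst_nonneg h (by omega) (by omega),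
    criticalOrbit_fst_nonneg h (by omega) (by omega)⟩

/-- The wedge is constant in j by area preservation, so its sign is read off at j = 0. -/
theorem wedge_criticalOrbit_four (h : IsResonant a b θ) {j : ℕ} (hj : j ≤ 5) :
    0 < wedge (criticalOrbit a b (j + 4)) (criticalOrbit a b j) := by
  induction j with
  | zero =>
    simp only [wedge, criticalOrbit_zero, criticalOrbit_four h]
    linarith [h.x4_neg]
  | succ j ih =>
    have e : j + 1 + 4 = j + 4 + 1 := by omega
    rw [e, ← planeMap_criticalOrbit a b (j + 4), ← planeMap_criticalOrbit a b j,
      wedge_planeMap (sameSide_criticalOrbit_four h (by omega))]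
    exact ih (by omega)

theorem wedge_criticalOrbit_five (h : IsResonant a b θ) {j : ℕ} (hj : j ≤ 4) :
    0 < wedge (criticalOrbit a b j) (criticalOrbit a b (j + 5)) := by
  induction j with
  | zero =>
    simp only [wedge, criticalOrbit_zero, criticalOrbit_five h]
    linarith [h.x3_pos]
  | succ j ih =>
    have e : j + 1 + 5 = j + 5 + 1 := by omega
    rw [e, ← planeMap_criticalOrbit a b (j + 5), ← planeMap_criticalOrbit a b j,
      wedge_planeMap (sameSide_criticalOrbit_five h (by omega))]
    exact ih (by omega)

/-- The orbit of an arc is an arc as long as no image of the arc crosses the vertical axis. -/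
theorem iterate_arc_alpha (h : IsResonant a b θ) {j : ℕ} (hj : j ≤ 5) {s : ℝ}
    (hs : s ∈ Set.Icc 0 (2 * π - 4 * θ)) :
    (planeMap a b)^[j] (arc (2 * π - 4 * θ) (criticalOrbit a b 4) (criticalOrbit a b 0) s) =
      arc (2 * π - 4 * θ) (criticalOrbit a b (j + 4)) (criticalOrbit a b j) s := by
  induction j with
  | zero => rfl
  | succ j ih =>
    rw [Function.iterate_succ_apply', ih (by omega),
      planeMap_arc (sameSide_criticalOrbit_four h (by omega)) (by linarith [h.lower]) hs,
      planeMap_criticalOrbit, planeMap_criticalOrbit, Nat.add_right_comm]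

theorem iterate_arc_beta (h : IsResonant a b θ) {j : ℕ} (hj : j ≤ 4) {s : ℝ}
    (hs : s ∈ Set.Icc 0 (π - 3 * θ)) :
    (planeMap a b)^[j] (arc (π - 3 * θ) (criticalOrbit a b 0) (criticalOrbit a b 5) s) =
      arc (π - 3 * θ) (criticalOrbit a b j) (criticalOrbit a b (j + 5)) s := by
  induction j with
  | zero => rfl
  | succ j ih =>
    rw [Function.iterate_succ_apply', ih (by omega),
      planeMap_arc (sameSide_criticalOrbit_five h (by omega)) (by linarith [h.lower, pi_pos]) hs,
      planeMap_criticalOrbit, planeMap_criticalOrbit, Nat.add_right_comm]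

/-! ### The invariant ellipse of the linear map with parameter `2 cos θ` -/

/-- Parametrisation of the ellipse `x ^ 2 - 2 cos θ x y + y ^ 2 = 1`. -/
noncomputable def ellipsePoint (θ t : ℝ) : ℝ × ℝ := (sin t / sin θ, sin (t - θ) / sin θ)

/-- All translates of the sine lie in a two-dimensional space, so a point of the ellipse is a
combination of the two ends of the arc with coefficients independent of the base point. -/
theorem ellipsePoint_add {l : ℝ} (hl : sin l ≠ 0) (θ u s : ℝ) :
    ellipsePoint θ (u + s) = arc l (ellipsePoint θ u) (ellipsePoint θ (u + l)) s := by
  have key : ∀ v, sin (v + s) = sin (l - s) / sin l * sin v + sin s / sin l * sin (v + l) := by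
    intro v
    rw [sin_add v, sin_add v, sin_sub]
    field_simp
    ring
  have e1 : u + s - θ = u - θ + s := by ring
  have e2 : u + l - θ = u - θ + l := by ring
  ext
  · simp only [ellipsePoint, arc, Prod.fst_add, Prod.smul_fst, smul_eq_mul]
    rw [key u]; ring
  · simp only [ellipsePoint, arc, Prod.snd_add, Prod.smul_snd, smul_eq_mul]
    rw [e1, e2, key (u - θ)]; ring

theorem continuous_ellipsePoint (θ : ℝ) : Continuous (ellipsePoint θ) := by
  unfold ellipsePoint; fun_prop

theorem ellipsePoint_add_two_pi (θ t : ℝ) : ellipsePoint θ (t + 2 * π) = ellipsePoint θ t := by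
  have e : t + 2 * π - θ = t - θ + 2 * π := by ring
  simp only [ellipsePoint, e, sin_add_two_pi]

theorem ellipsePoint_add_pi (θ t : ℝ) : ellipsePoint θ (t + π) = -ellipsePoint θ t := by
  have e : t + π - θ = t - θ + π := by ring
  ext <;> simp [ellipsePoint, e, sin_add_pi, neg_div]

theorem ellipsePoint_zero (hθ : sin θ ≠ 0) : ellipsePoint θ 0 = criticalOrbit a b 0 := by
  ext <;> simp [ellipsePoint, criticalOrbit_zero, hθ]

theorem ellipsePoint_four (h : IsResonant a b θ) :
    ellipsePoint θ (4 * θ) = criticalOrbit a b 4 := by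
  have hs := h.sin_pos.ne'
  have e1 : 4 * θ = 2 * (2 * θ) := by ring
  have e2 : 4 * θ - θ = 3 * θ := by ring
  rw [criticalOrbit_four h, ellipsePoint, e2, e1, sin_three_mul, sin_two_mul, sin_two_mul,
    cos_two_mul, h.a_eq]
  ext
  · field_simp
  · field_simp; linear_combination (-4) * sin_sq_add_cos_sq θ

/-- The ellipse is symmetric under the swap of coordinates, which acts as t ↦ π + θ − t and sends 4θ
to π − 3θ. -/
theorem ellipsePoint_five (h : IsResonant a b θ) :
    ellipsePoint θ (π - 3 * θ) = criticalOrbit a b 5 := by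
  have h4 := ellipsePoint_four h
  rw [criticalOrbit_four h] at h4
  have e1 : π - 3 * θ = π - (4 * θ - θ) := by ring
  have e2 : π - 3 * θ - θ = π - 4 * θ := by ring
  rw [criticalOrbit_five h, ellipsePoint, e2, e1, sin_pi_sub, sin_pi_sub]
  exact Prod.ext (congrArg Prod.snd h4) (congrArg Prod.fst h4)

theorem ellipsePoint_nine (h : IsResonant a b θ) :
    ellipsePoint θ (π + θ) = criticalOrbit a b 9 := by
  rw [criticalOrbit_nine h, add_comm, ellipsePoint_add_pi]
  ext <;> simp [ellipsePoint, h.sin_pos.ne']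

theorem ellipsePoint_isCentredEllipse (h : IsResonant a b θ) :
    IsCentredEllipse {p | 1 * p.1 ^ 2 + (-a) * (p.1 * p.2) + 1 * p.2 ^ 2 = 1} := by
  refine ⟨1, -a, 1, one_pos, ?_, rfl⟩
  linarith [h.a_sq_lt_two, neg_sq a]

theorem ellipsePoint_mem (h : IsResonant a b θ) (t : ℝ) :
    ellipsePoint θ t ∈ {p : ℝ × ℝ | 1 * p.1 ^ 2 + (-a) * (p.1 * p.2) + 1 * p.2 ^ 2 = 1} := by
  have hs := h.sin_pos.ne'
  simp only [Set.mem_ofPred_eq, ellipsePoint, h.a_eq]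
  field_simp
  rw [sin_sub]
  linear_combination (-sin t ^ 2) * sin_sq_add_cos_sq θ + sin θ ^ 2 * sin_sq_add_cos_sq t

end orbit

/-! ### The invariant curve -/

/-- A parametrised curve on which the plane map acts as the translation by `3 π - 7 θ` of the
parameter. -/
noncomputable def invariantCurve (a b θ s : ℝ) : ℝ × ℝ :=
  (planeEquiv a b ^ ⌊s / (3 * π - 7 * θ)⌋)
    (ellipsePoint θ (4 * θ + (s - ⌊s / (3 * π - 7 * θ)⌋ * (3 * π - 7 * θ))))

section curve

variable {a b θ : ℝ}

theorem invariantCurve_add_step (h : IsResonant a b θ) (s : ℝ) :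
    invariantCurve a b θ (s + (3 * π - 7 * θ)) = planeMap a b (invariantCurve a b θ s) := by
  have hω := h.step_pos.ne'
  have e : ⌊(s + (3 * π - 7 * θ)) / (3 * π - 7 * θ)⌋ = 1 + ⌊s / (3 * π - 7 * θ)⌋ := by
    rw [add_div, div_self hω, Int.floor_add_one, add_comm]
  have e2 : s + (3 * π - 7 * θ) - ((1 + ⌊s / (3 * π - 7 * θ)⌋ : ℤ) : ℝ) * (3 * π - 7 * θ) =
      s - ⌊s / (3 * π - 7 * θ)⌋ * (3 * π - 7 * θ) := by
    push_cast; ring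
  rw [invariantCurve, e, e2, zpow_one_add, Equiv.Perm.mul_apply, planeEquiv_apply]
  rfl

theorem invariantCurve_add_nat_mul_step (h : IsResonant a b θ) (s : ℝ) (j : ℕ) :
    invariantCurve a b θ (s + j * (3 * π - 7 * θ)) =
      (planeMap a b)^[j] (invariantCurve a b θ s) := by
  induction j with
  | zero => simp
  | succ j ih =>
    rw [Function.iterate_succ_apply', ← ih, ← invariantCurve_add_step h]
    congr 1; push_cast; ring

theorem invariantCurve_add_int_mul_step (h : IsResonant a b θ) (s : ℝ) (n : ℤ) :
    invariantCurve a b θ (s + n * (3 * π - 7 * θ)) =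
      (planeEquiv a b ^ n) (invariantCurve a b θ s) := by
  have hω := h.step_pos.ne'
  have e : ⌊(s + n * (3 * π - 7 * θ)) / (3 * π - 7 * θ)⌋ = n + ⌊s / (3 * π - 7 * θ)⌋ := by
    rw [add_div, mul_div_cancel_right₀ _ hω, Int.floor_add_intCast, add_comm]
  have e2 : s + n * (3 * π - 7 * θ) - ((n + ⌊s / (3 * π - 7 * θ)⌋ : ℤ) : ℝ) * (3 * π - 7 * θ) =
      s - ⌊s / (3 * π - 7 * θ)⌋ * (3 * π - 7 * θ) := by
    push_cast; ring
  rw [invariantCurve, e, e2, zpow_add, Equiv.Perm.mul_apply]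
  rfl

theorem ellipsePoint_eq_arc_alpha (h : IsResonant a b θ) (s : ℝ) :
    ellipsePoint θ (4 * θ + s) =
      arc (2 * π - 4 * θ) (criticalOrbit a b 4) (criticalOrbit a b 0) s := by
  have e : 4 * θ + (2 * π - 4 * θ) = 0 + 2 * π := by ring
  rw [ellipsePoint_add h.sin_alpha_pos.ne', e, ellipsePoint_add_two_pi, ellipsePoint_four h,
    ellipsePoint_zero (a := a) (b := b) h.sin_pos.ne']

theorem ellipsePoint_eq_arc_beta (h : IsResonant a b θ) (s : ℝ) :
    ellipsePoint θ s = arc (π - 3 * θ) (criticalOrbit a b 0) (criticalOrbit a b 5) s := by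
  rw [← zero_add s, ellipsePoint_add h.sin_beta_pos.ne', zero_add, ellipsePoint_five h,
    ellipsePoint_zero (a := a) (b := b) h.sin_pos.ne', zero_add]

/-- Together with `ellipsePoint_pi_add` this cuts the fundamental arc at the ninth orbit point, in
the order β then α, to be matched with the fourth and fifth images of its two parts. -/
theorem ellipsePoint_add_four_mul (h : IsResonant a b θ) (s : ℝ) :
    ellipsePoint θ (4 * θ + s) =
      arc (π - 3 * θ) (criticalOrbit a b 4) (criticalOrbit a b 9) s := by
  have e : 4 * θ + (π - 3 * θ) = π + θ := by ring
  rw [ellipsePoint_add h.sin_beta_pos.ne', e, ellipsePoint_four h, ellipsePoint_nine h]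

theorem ellipsePoint_pi_add (h : IsResonant a b θ) (s : ℝ) :
    ellipsePoint θ (π + θ + s) =
      arc (2 * π - 4 * θ) (criticalOrbit a b 9) (criticalOrbit a b 5) s := by
  have e : π + θ + (2 * π - 4 * θ) = (π - 3 * θ) + 2 * π := by ring
  rw [ellipsePoint_add h.sin_alpha_pos.ne', e, ellipsePoint_add_two_pi, ellipsePoint_nine h,
    ellipsePoint_five h]

theorem invariantCurve_eq_ellipsePoint (h : IsResonant a b θ) {s : ℝ}
    (hs : s ∈ Set.Icc 0 (3 * π - 7 * θ)) :
    invariantCurve a b θ s = ellipsePoint θ (4 * θ + s) := by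
  have key : ∀ s ∈ Set.Ico 0 (3 * π - 7 * θ),
      invariantCurve a b θ s = ellipsePoint θ (4 * θ + s) := by
    intro s hs
    have e : ⌊s / (3 * π - 7 * θ)⌋ = 0 := by
      rw [Int.floor_eq_zero_iff]
      exact ⟨div_nonneg hs.1 h.step_pos.le, (div_lt_one h.step_pos).2 hs.2⟩
    simp [invariantCurve, e]
  rcases hs.2.lt_or_eq with h1 | h1
  · exact key s ⟨hs.1, h1⟩
  -- At the right endpoint the floor jumps to 1. The formulas still agree because T sends the start
  -- of the fundamental arc to its end.
  · have e : 4 * θ + (3 * π - 7 * θ) = (π - 3 * θ) + 2 * π := by ring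
    have h2 := invariantCurve_add_step h 0
    rw [zero_add, key 0 ⟨le_rfl, h.step_pos⟩, add_zero, ellipsePoint_four h,
      planeMap_criticalOrbit] at h2
    rw [h1, h2, e, ellipsePoint_add_two_pi, ellipsePoint_five h]

theorem invariantCurve_alpha (h : IsResonant a b θ) {j : ℕ} (hj : j ≤ 5) {s : ℝ}
    (hs : s ∈ Set.Icc 0 (2 * π - 4 * θ)) :
    invariantCurve a b θ (s + j * (3 * π - 7 * θ)) =
      arc (2 * π - 4 * θ) (criticalOrbit a b (j + 4)) (criticalOrbit a b j) s := by
  rw [invariantCurve_add_nat_mul_step h, invariantCurve_eq_ellipsePoint h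
    ⟨hs.1, by linarith [hs.2, h.upper]⟩, ellipsePoint_eq_arc_alpha h, iterate_arc_alpha h hj hs]

theorem invariantCurve_beta (h : IsResonant a b θ) {j : ℕ} (hj : j ≤ 4) {s : ℝ}
    (hs : s ∈ Set.Icc 0 (π - 3 * θ)) :
    invariantCurve a b θ (s + (2 * π - 4 * θ) + j * (3 * π - 7 * θ)) =
      arc (π - 3 * θ) (criticalOrbit a b j) (criticalOrbit a b (j + 5)) s := by
  have e : 4 * θ + (s + (2 * π - 4 * θ)) = s + 2 * π := by ring
  rw [invariantCurve_add_nat_mul_step h, invariantCurve_eq_ellipsePoint h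
    ⟨by linarith [hs.1, h.upper, pi_pos], by linarith [hs.2]⟩, e, ellipsePoint_add_two_pi,
    ellipsePoint_eq_arc_beta h, iterate_arc_beta h hj hs]

/-- On the fundamental arc, a shift by L = 4ω + α lands in the fourth image of the β-part or the
fifth image of the α-part. These are the two pieces of the fundamental arc cut at the ninth orbit
point. Equivariance under T extends this to every s. -/
theorem invariantCurve_add_length (h : IsResonant a b θ) (s : ℝ) :
    invariantCurve a b θ (s + (14 * π - 32 * θ)) = invariantCurve a b θ s := by
  have key : ∀ s ∈ Set.Icc 0 (3 * π - 7 * θ),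
      invariantCurve a b θ (s + (14 * π - 32 * θ)) = invariantCurve a b θ s := by
    intro s hs
    rw [invariantCurve_eq_ellipsePoint h hs]
    rcases le_total s (π - 3 * θ) with h1 | h1
    · have e : s + (14 * π - 32 * θ) =
          s + (2 * π - 4 * θ) + (4 : ℕ) * (3 * π - 7 * θ) := by push_cast; ring
      rw [e, invariantCurve_beta h le_rfl ⟨hs.1, h1⟩, ellipsePoint_add_four_mul h]
    · have e : s + (14 * π - 32 * θ) =
          (s - (π - 3 * θ)) + (5 : ℕ) * (3 * π - 7 * θ) := by push_cast; ring
      have e2 : 4 * θ + s = π + θ + (s - (π - 3 * θ)) := by ring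
      rw [e, invariantCurve_alpha h le_rfl ⟨by linarith, by linarith [hs.2]⟩, e2,
        ellipsePoint_pi_add h]
  set n := ⌊s / (3 * π - 7 * θ)⌋ with hn
  have h1 : (n : ℝ) * (3 * π - 7 * θ) ≤ s := (le_div_iff₀ h.step_pos).1 (Int.floor_le _)
  have h2 : s < (n + 1) * (3 * π - 7 * θ) := (div_lt_iff₀ h.step_pos).1 (Int.lt_floor_add_one _)
  have e : s = (s - n * (3 * π - 7 * θ)) + n * (3 * π - 7 * θ) := by ring
  have k := key (s - n * (3 * π - 7 * θ)) ⟨by linarith, by linarith⟩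
  rw [e, add_right_comm, invariantCurve_add_int_mul_step h, invariantCurve_add_int_mul_step h, k]

theorem continuous_invariantCurve (h : IsResonant a b θ) : Continuous (invariantCurve a b θ) := by
  have h0 : ContinuousOn (invariantCurve a b θ) (Set.Icc 0 (3 * π - 7 * θ)) :=
    ((continuous_ellipsePoint θ).comp (continuous_const.add continuous_id)).continuousOn.congr
      fun s hs => invariantCurve_eq_ellipsePoint h hs
  have hn : ∀ n : ℤ, ContinuousOn (invariantCurve a b θ)
      (Set.Icc (n * (3 * π - 7 * θ)) ((n + 1) * (3 * π - 7 * θ))) := by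
    intro n
    have h1 : ContinuousOn (fun s => (planeEquiv a b ^ n)
        (invariantCurve a b θ (s - n * (3 * π - 7 * θ))))
        (Set.Icc (n * (3 * π - 7 * θ)) ((n + 1) * (3 * π - 7 * θ))) := by
      refine (continuous_planeEquiv_zpow a b n).comp_continuousOn
        (h0.comp (by fun_prop) fun s hs => ⟨?_, ?_⟩)
      · linarith [hs.1]
      · linarith [hs.2]
    refine h1.congr fun s _ => ?_
    beta_reduce
    rw [← invariantCurve_add_int_mul_step h, sub_add_cancel]
  rw [continuous_iff_continuousAt]
  intro s
  set n := ⌊s / (3 * π - 7 * θ)⌋ with hn'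
  have h1 : (n : ℝ) * (3 * π - 7 * θ) ≤ s := (le_div_iff₀ h.step_pos).1 (Int.floor_le _)
  have h2 : s < (n + 1) * (3 * π - 7 * θ) := (div_lt_iff₀ h.step_pos).1 (Int.lt_floor_add_one _)
  -- Two adjacent cells are needed for a neighbourhood, since s may be the left endpoint of cell n.
  have hu := (hn (n - 1)).union_of_isClosed (hn n) isClosed_Icc isClosed_Icc
  refine hu.continuousAt ?_
  push_cast
  rw [sub_add_cancel, Set.Icc_union_Icc_eq_Icc (by linarith [h.step_pos]) (by linarith)]
  exact Icc_mem_nhds (by linarith [h.step_pos]) h2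

/-- From `(0, -1)` to `(0, 1)` the curve stays in the right half-plane. -/
theorem invariantCurve_fst_nonneg (h : IsResonant a b θ) {s : ℝ}
    (h1 : 2 * π - 4 * θ ≤ s) (h2 : s ≤ 4 * (3 * π - 7 * θ)) :
    0 ≤ (invariantCurve a b θ s).1 := by
  have hα : ∀ j : ℕ, 1 ≤ j → j ≤ 3 → ∀ u ∈ Set.Icc 0 (2 * π - 4 * θ),
      0 ≤ (invariantCurve a b θ (u + j * (3 * π - 7 * θ))).1 := by
    intro j hj1 hj3 u hu
    rw [invariantCurve_alpha h (by omega) hu]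
    exact arc_fst_nonneg (criticalOrbit_fst_nonneg h (by omega) (by omega))
      (criticalOrbit_fst_nonneg h (by omega) (by omega)) (by linarith [h.lower]) hu
  have hβ : ∀ j : ℕ, j ≤ 3 → ∀ u ∈ Set.Icc 0 (π - 3 * θ),
      0 ≤ (invariantCurve a b θ (u + (2 * π - 4 * θ) + j * (3 * π - 7 * θ))).1 := by
    intro j hj3 u hu
    rw [invariantCurve_beta h (by omega) hu]
    exact arc_fst_nonneg (criticalOrbit_fst_nonneg h (by omega) (by omega))
      (criticalOrbit_fst_nonneg h (by omega) (by omega)) (by linarith [h.lower, pi_pos]) hu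
  have key : ∀ j : ℕ, j ≤ 3 → ∀ u : ℝ, 0 ≤ u → u ≤ 3 * π - 7 * θ →
      (j = 0 → 2 * π - 4 * θ ≤ u) → 0 ≤ (invariantCurve a b θ (u + j * (3 * π - 7 * θ))).1 := by
    intro j hj u hu0 hu1 hu
    rcases le_total (2 * π - 4 * θ) u with hc | hc
    · have := hβ j hj (u - (2 * π - 4 * θ)) ⟨by linarith, by linarith⟩
      rwa [sub_add_cancel] at this
    · by_cases hj0 : j = 0
      · have := hβ j hj (u - (2 * π - 4 * θ)) ⟨by linarith [hu hj0], by linarith⟩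
        rwa [sub_add_cancel] at this
      · exact hα j (by omega) hj u ⟨hu0, hc⟩
  have hω := h.step_pos
  set n := ⌊s / (3 * π - 7 * θ)⌋₊ with hn
  have hs0 : 0 ≤ s := by linarith [h.upper, pi_pos]
  have n1 : (n : ℝ) * (3 * π - 7 * θ) ≤ s :=
    (le_div_iff₀ hω).1 (Nat.floor_le (div_nonneg hs0 hω.le))
  have n2 : s < (n + 1) * (3 * π - 7 * θ) := (div_lt_iff₀ hω).1 (Nat.lt_floor_add_one _)
  by_cases hn4 : n ≤ 3
  · have := key n hn4 (s - n * (3 * π - 7 * θ)) (by linarith) (by linarith)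
      (fun h0 => by rw [h0]; simpa using h1)
    rwa [sub_add_cancel] at this
  -- Only the endpoint s = 4ω remains; it is treated as the right end of cell 3.
  · have h4 : (4 : ℝ) ≤ n := by exact_mod_cast (by omega : 4 ≤ n)
    have hs : s = 4 * (3 * π - 7 * θ) := by nlinarith
    have := key 3 le_rfl (3 * π - 7 * θ) hω.le le_rfl (by norm_num)
    rw [hs]
    convert this using 3
    push_cast; ring

/-- From `(0, 1)` to `(0, -1)` the curve stays in the left half-plane. -/
theorem invariantCurve_fst_nonpos (h : IsResonant a b θ) {s : ℝ}
    (h1 : 4 * (3 * π - 7 * θ) ≤ s) (h2 : s ≤ (2 * π - 4 * θ) + (14 * π - 32 * θ)) :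
    (invariantCurve a b θ s).1 ≤ 0 := by
  have h4 : (criticalOrbit a b 4).1 ≤ 0 := by rw [criticalOrbit_four h]; exact h.x4_neg.le
  have hl : 2 * π - 4 * θ < π := by linarith [h.lower]
  rcases le_total s (14 * π - 32 * θ) with hc | hc
  · have hu : s - (4 : ℕ) * (3 * π - 7 * θ) ∈ Set.Icc 0 (2 * π - 4 * θ) := by
      push_cast; exact ⟨by linarith, by linarith⟩
    rw [← sub_add_cancel s ((4 : ℕ) * (3 * π - 7 * θ)), invariantCurve_alpha h (by norm_num) hu]
    exact arc_fst_nonpos (by simp [criticalOrbit_eight h]) h4 hl hu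
  · have hu : s - (14 * π - 32 * θ) ∈ Set.Icc 0 (2 * π - 4 * θ) := ⟨by linarith, by linarith⟩
    have e : s - (14 * π - 32 * θ) = s - (14 * π - 32 * θ) + (0 : ℕ) * (3 * π - 7 * θ) := by simp
    rw [← sub_add_cancel s (14 * π - 32 * θ), invariantCurve_add_length h, e,
      invariantCurve_alpha h (by norm_num) hu]
    exact arc_fst_nonpos h4 (by simp [criticalOrbit_zero]) hl hu

theorem invariantCurve_ne_zero (h : IsResonant a b θ) (s : ℝ) : invariantCurve a b θ s ≠ 0 := by
  intro h0
  have hz : (planeEquiv a b ^ ⌊s / (3 * π - 7 * θ)⌋) 0 = 0 :=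
    Equiv.Perm.zpow_apply_eq_self_of_apply_eq_self (planeMap_zero a b) _
  rw [invariantCurve, ← hz] at h0
  have := ellipsePoint_mem h (4 * θ + (s - ⌊s / (3 * π - 7 * θ)⌋ * (3 * π - 7 * θ)))
  rw [(planeEquiv a b ^ ⌊s / (3 * π - 7 * θ)⌋).injective h0] at this
  simp at this

theorem wedge_invariantCurve_alpha (h : IsResonant a b θ) {j : ℕ} (hj : j ≤ 4) {s t : ℝ}
    (hs : j * (3 * π - 7 * θ) ≤ s) (hst : s < t)
    (ht : t ≤ j * (3 * π - 7 * θ) + (2 * π - 4 * θ)) :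
    0 < wedge (invariantCurve a b θ s) (invariantCurve a b θ t) := by
  rw [← sub_add_cancel s (j * (3 * π - 7 * θ)), ← sub_add_cancel t (j * (3 * π - 7 * θ)),
    invariantCurve_alpha h (by omega) ⟨by linarith, by linarith⟩,
    invariantCurve_alpha h (by omega) ⟨by linarith, by linarith⟩, wedge_arc h.sin_alpha_pos.ne']
  exact div_pos (mul_pos (wedge_criticalOrbit_four h (by omega))
    (sin_pos_of_pos_of_lt_pi (by linarith) (by linarith [h.lower]))) h.sin_alpha_pos

theorem wedge_invariantCurve_beta (h : IsResonant a b θ) {j : ℕ} (hj : j ≤ 4) {s t : ℝ}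
    (hs : j * (3 * π - 7 * θ) + (2 * π - 4 * θ) ≤ s) (hst : s < t)
    (ht : t ≤ (j + 1) * (3 * π - 7 * θ)) :
    0 < wedge (invariantCurve a b θ s) (invariantCurve a b θ t) := by
  have e : ∀ s, s = s - (2 * π - 4 * θ) - j * (3 * π - 7 * θ) + (2 * π - 4 * θ) +
      j * (3 * π - 7 * θ) := fun s => by ring
  rw [e s, e t,
    invariantCurve_beta h (by omega) ⟨by linarith, by linarith⟩,
    invariantCurve_beta h (by omega) ⟨by linarith, by linarith⟩, wedge_arc h.sin_beta_pos.ne']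
  exact div_pos (mul_pos (wedge_criticalOrbit_five h (by omega))
    (sin_pos_of_pos_of_lt_pi (by linarith) (by linarith [h.lower, pi_pos]))) h.sin_beta_pos

end curve

/-! ### Polar coordinates along a star-shaped curve -/

/-- Euclidean length. -/
noncomputable def euclidLength (p : ℝ × ℝ) : ℝ := √(p.1 ^ 2 + p.2 ^ 2)

theorem euclidLength_pos {p : ℝ × ℝ} (hp : p ≠ 0) : 0 < euclidLength p := by
  refine sqrt_pos.2 ?_
  by_contra! h
  exact hp (Prod.ext (by simp; nlinarith [sq_nonneg p.1, sq_nonneg p.2])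
    (by simp; nlinarith [sq_nonneg p.1, sq_nonneg p.2]))

theorem euclidLength_smul {c : ℝ} (hc : 0 ≤ c) (p : ℝ × ℝ) :
    euclidLength (c • p) = c * euclidLength p := by
  simp only [euclidLength, Prod.smul_fst, Prod.smul_snd, smul_eq_mul, mul_pow, ← mul_add]
  rw [sqrt_mul (sq_nonneg c), sqrt_sq hc]

theorem radialProj_eq_smul (p : ℝ × ℝ) : radialProj p = (euclidLength p)⁻¹ • p := by
  ext <;> simp [radialProj, euclidLength, div_eq_inv_mul]

theorem radialProj_smul {c : ℝ} (hc : 0 < c) (p : ℝ × ℝ) : radialProj (c • p) = radialProj p := by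
  rw [radialProj_eq_smul, radialProj_eq_smul, euclidLength_smul hc.le, smul_smul, mul_inv,
    mul_right_comm, inv_mul_cancel₀ hc.ne', one_mul]

theorem euclidLength_smul_radialProj {p : ℝ × ℝ} (hp : p ≠ 0) :
    euclidLength p • radialProj p = p := by
  rw [radialProj_eq_smul, smul_smul, mul_inv_cancel₀ (euclidLength_pos hp).ne', one_smul]

theorem exists_circlePoint_eq_radialProj {p : ℝ × ℝ} (hp : p ≠ 0) :
    ∃ t, radialProj p = circlePoint t := by
  have h := euclidLength_pos hp
  have hn : ‖(⟨(radialProj p).1, (radialProj p).2⟩ : ℂ)‖ = 1 := by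
    rw [Complex.norm_def, sqrt_eq_one, Complex.normSq_mk]
    have hq : euclidLength p ^ 2 = p.1 ^ 2 + p.2 ^ 2 := sq_sqrt (by positivity)
    simp only [radialProj_eq_smul, Prod.smul_fst, Prod.smul_snd, smul_eq_mul]
    field_simp
    linarith
  have hz : (⟨(radialProj p).1, (radialProj p).2⟩ : ℂ) ≠ 0 := by
    intro h0; simp [h0] at hn
  have h2 : 2 * π * (Complex.arg ⟨(radialProj p).1, (radialProj p).2⟩ / (2 * π)) =
      Complex.arg ⟨(radialProj p).1, (radialProj p).2⟩ := by
    field_simp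
  refine ⟨Complex.arg ⟨(radialProj p).1, (radialProj p).2⟩ / (2 * π), ?_⟩
  rw [circlePoint, h2, Complex.cos_arg hz, Complex.sin_arg, hn]
  simp

/-- A continuous curve avoiding the origin has a continuous angle. -/
theorem exists_continuous_angle {g : ℝ → ℝ × ℝ} (hg : Continuous g) (h0 : ∀ s, g s ≠ 0) :
    ∃ φ : ℝ → ℝ, Continuous φ ∧ ∀ s, radialProj (g s) = circlePoint (φ s) := by
  obtain ⟨t₀, ht₀⟩ := exists_circlePoint_eq_radialProj (h0 0)
  set f : C(ℝ, ℂ) := ⟨fun s => (⟨(g s).1, (g s).2⟩ : ℂ), by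
    have : (fun s => (⟨(g s).1, (g s).2⟩ : ℂ)) = Complex.equivRealProdCLM.symm ∘ g := rfl
    rw [this]
    exact Complex.equivRealProdCLM.symm.continuous.comp hg⟩ with hf
  have hf0 : ∀ s, f s ≠ 0 := fun s hs =>
    h0 s (Prod.ext (congrArg Complex.re hs) (congrArg Complex.im hs))
  -- The curve lifts through the exponential covering of the punctured plane; the imaginary part of
  -- the lift is the angle.
  obtain ⟨F, ⟨-, hF⟩, -⟩ := Complex.isCoveringMapOn_exp.existsUnique_continuousMap_lifts f
    (Complex.exp_log (hf0 0)) hf0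
  refine ⟨fun s => (F s).im / (2 * π), by fun_prop, fun s => ?_⟩
  have e : 2 * π * ((F s).im / (2 * π)) = (F s).im := by field_simp
  have hs : Complex.exp (F s) = f s := congrFun hF s
  have h1 : (g s).1 = Real.exp (F s).re * cos (F s).im := by
    rw [← Complex.exp_re, hs]; rfl
  have h2 : (g s).2 = Real.exp (F s).re * sin (F s).im := by
    rw [← Complex.exp_im, hs]; rfl
  have h3 : g s = Real.exp (F s).re • (cos (F s).im, sin (F s).im) := Prod.ext h1 h2
  rw [h3, radialProj_smul (Real.exp_pos _), circlePoint, e]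
  simp [radialProj]

theorem wedge_eq_of_angle {p q : ℝ × ℝ} (hp : p ≠ 0) (hq : q ≠ 0) {s t : ℝ}
    (hs : radialProj p = circlePoint s) (ht : radialProj q = circlePoint t) :
    wedge p q = euclidLength p * euclidLength q * sin (2 * π * (t - s)) := by
  have ep := euclidLength_smul_radialProj hp
  have eq := euclidLength_smul_radialProj hq
  rw [hs] at ep
  rw [ht] at eq
  rw [mul_sub, sin_sub]
  conv_lhs => rw [← ep, ← eq]
  simp only [wedge, circlePoint, Prod.smul_fst, Prod.smul_snd, smul_eq_mul]
  ring

/-- If the angle failed to increase, positivity of the sine would force a drop of more than half a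
turn; by continuity some intermediate drop is a quarter turn, where the sine is −1. -/
theorem strictMonoOn_of_sin_pos {φ : ℝ → ℝ} (hφ : Continuous φ) {c d : ℝ}
    (h : ∀ s t, c ≤ s → s < t → t ≤ d → 0 < sin (2 * π * (φ t - φ s))) :
    StrictMonoOn φ (Set.Icc c d) := by
  intro s hs t ht hst
  by_contra! hle
  have hπ := pi_pos
  have h1 : φ t - φ s < -(1 / 2) := by
    by_contra! h2
    exact (h s t hs.1 hst ht.2).not_ge
      (sin_nonpos_of_nonpos_of_neg_pi_le (by nlinarith) (by nlinarith))
  obtain ⟨u, hu, hu'⟩ : φ s - 1 / 4 ∈ φ '' Set.Icc s t :=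
    intermediate_value_Icc' hst.le hφ.continuousOn ⟨by linarith, by linarith⟩
  have hsu : s < u := by
    refine lt_of_le_of_ne hu.1 ?_
    rintro rfl; linarith
  have := h s u hs.1 hsu (hu.2.trans ht.2)
  have e : 2 * π * (φ u - φ s) = -(π / 2) := by rw [hu']; ring
  rw [e, sin_neg, sin_pi_div_two] at this
  linarith

/-- An angle that increases from a downward to an upward direction within the right half-plane
increases by a half turn. -/
theorem eq_add_half_of_cos_nonneg {φ : ℝ → ℝ} (hφ : Continuous φ) {c d : ℝ} (hcd : c ≤ d)
    (h : φ c < φ d) {k m : ℤ} (hc : φ c = -(1 / 4) + k) (hd : φ d = 1 / 4 + m)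
    (hcos : ∀ s ∈ Set.Icc c d, 0 ≤ cos (2 * π * φ s)) : φ d = φ c + 1 / 2 := by
  have hkm : k ≤ m := by
    by_contra! hlt
    have : (m : ℝ) + 1 ≤ k := by exact_mod_cast hlt
    linarith
  rcases hkm.eq_or_lt with rfl | hlt
  · rw [hc, hd]; ring
  · have hlt' : (k : ℝ) + 1 ≤ m := by exact_mod_cast hlt
    obtain ⟨u, hu, hu'⟩ : (k : ℝ) + 1 / 2 ∈ φ '' Set.Icc c d :=
      intermediate_value_Icc hcd hφ.continuousOn ⟨by linarith, by linarith⟩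
    have := hcos u hu
    have e : 2 * π * φ u = π + k * (2 * π) := by rw [hu']; ring
    rw [e, cos_add_int_mul_two_pi, cos_pi] at this
    linarith

theorem exists_int_of_circlePoint_eq_up {t : ℝ} (h : circlePoint t = (0, 1)) :
    ∃ k : ℤ, t = 1 / 4 + k := by
  refine (circlePoint_eq_iff t (1 / 4)).1 (h.trans ?_)
  have e : 2 * π * (1 / 4) = π / 2 := by ring
  simp only [circlePoint, e, cos_pi_div_two, sin_pi_div_two]

theorem exists_int_of_circlePoint_eq_down {t : ℝ} (h : circlePoint t = (0, -1)) :
    ∃ k : ℤ, t = -(1 / 4) + k := by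
  refine (circlePoint_eq_iff t (-(1 / 4))).1 (h.trans ?_)
  have e : 2 * π * -(1 / 4) = -(π / 2) := by ring
  simp only [circlePoint, e, cos_neg, sin_neg, cos_pi_div_two, sin_pi_div_two]

theorem cos_nonneg_of_angle {p : ℝ × ℝ} (hp : 0 ≤ p.1) {t : ℝ}
    (ht : radialProj p = circlePoint t) : 0 ≤ cos (2 * π * t) := by
  have := congrArg Prod.fst ht
  rw [show cos (2 * π * t) = (circlePoint t).1 from rfl, ← this]
  exact div_nonneg hp (sqrt_nonneg _)

theorem cos_nonpos_of_angle {p : ℝ × ℝ} (hp : p.1 ≤ 0) {t : ℝ}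
    (ht : radialProj p = circlePoint t) : cos (2 * π * t) ≤ 0 := by
  have := congrArg Prod.fst ht
  rw [show cos (2 * π * t) = (circlePoint t).1 from rfl, ← this]
  exact div_nonpos_of_nonpos_of_nonneg hp (sqrt_nonneg _)

/-! ### The angle along the invariant curve -/

section angle

variable {a b θ : ℝ}

theorem strictMonoOn_angle (h : IsResonant a b θ) {φ : ℝ → ℝ} (hφ : Continuous φ)
    (hang : ∀ s, radialProj (invariantCurve a b θ s) = circlePoint (φ s)) :
    StrictMonoOn φ (Set.Icc 0 (14 * π - 32 * θ)) := by
  have hω := h.step_pos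
  have hα : 0 < 2 * π - 4 * θ := by linarith [h.upper, pi_pos]
  have hβ : 0 < π - 3 * θ := by linarith [h.upper]
  have sin_pos_of_wedge : ∀ s t,
      0 < wedge (invariantCurve a b θ s) (invariantCurve a b θ t) →
      0 < sin (2 * π * (φ t - φ s)) := by
    intro s t hw
    have hs := invariantCurve_ne_zero h s
    have ht := invariantCurve_ne_zero h t
    rw [wedge_eq_of_angle hs ht (hang s) (hang t)] at hw
    exact pos_of_mul_pos_right hw
      (mul_nonneg (euclidLength_pos hs).le (euclidLength_pos ht).le)
  have hA : ∀ j : ℕ, j ≤ 4 → StrictMonoOn φ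
      (Set.Icc (j * (3 * π - 7 * θ)) (j * (3 * π - 7 * θ) + (2 * π - 4 * θ))) := fun j hj =>
    strictMonoOn_of_sin_pos hφ fun s t hs hst ht =>
      sin_pos_of_wedge s t (wedge_invariantCurve_alpha h hj hs hst ht)
  have hB : ∀ j : ℕ, j ≤ 4 → StrictMonoOn φ
      (Set.Icc (j * (3 * π - 7 * θ) + (2 * π - 4 * θ)) ((j + 1) * (3 * π - 7 * θ))) := fun j hj =>
    strictMonoOn_of_sin_pos hφ fun s t hs hst ht =>
      sin_pos_of_wedge s t (wedge_invariantCurve_beta h hj hs hst ht)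
  have glue : ∀ {x y z : ℝ}, x ≤ y → y ≤ z → StrictMonoOn φ (Set.Icc x y) →
      StrictMonoOn φ (Set.Icc y z) → StrictMonoOn φ (Set.Icc x z) := by
    intro x y z hxy hyz h1 h2
    rw [← Set.Icc_union_Icc_eq_Icc hxy hyz]
    exact h1.union h2 (isGreatest_Icc hxy) (isLeast_Icc hyz)
  have hAB : ∀ j : ℕ, j ≤ 4 → StrictMonoOn φ (Set.Icc 0 (j * (3 * π - 7 * θ))) := by
    intro j
    induction j with
    | zero => intro _; simp
    | succ j ih =>
      intro hj
      have hj0 : 0 ≤ j * (3 * π - 7 * θ) := by positivity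
      have := glue (by linarith) (by linarith) (hA j (by omega)) (hB j (by omega))
      push_cast
      exact glue hj0 (by linarith) (ih (by omega)) this
  have e : ((4 : ℕ) : ℝ) * (3 * π - 7 * θ) + (2 * π - 4 * θ) = 14 * π - 32 * θ := by
    push_cast; ring
  rw [← e]
  exact glue (by positivity) (by linarith) (hAB 4 le_rfl) (hA 4 le_rfl)

/-- The increment over one period is an integer, constant by continuity. It is evaluated from (0,
−1): half a turn through the right half-plane up to (0, 1), then half a turn back through the left.
-/
theorem angle_add_length (h : IsResonant a b θ) {φ : ℝ → ℝ} (hφ : Continuous φ)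
    (hang : ∀ s, radialProj (invariantCurve a b θ s) = circlePoint (φ s)) (s : ℝ) :
    φ (s + (14 * π - 32 * θ)) = φ s + 1 := by
  have hω := h.step_pos
  have hmono := strictMonoOn_angle h hφ hang
  have key : ∀ t, ∃ m : ℤ, φ (t + (14 * π - 32 * θ)) = φ t + m := fun t =>
    (circlePoint_eq_iff _ _).1 (by rw [← hang, ← hang, invariantCurve_add_length h])
  choose m hm using key
  have hmc : Continuous m := by
    rw [Int.isClosedEmbedding_coe_real.isEmbedding.continuous_iff]
    have : ((fun n : ℤ => (n : ℝ)) ∘ m) = fun t => φ (t + (14 * π - 32 * θ)) - φ t := by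
      funext t
      simp [hm t]
    rw [this]
    exact (hφ.comp (by fun_prop)).sub hφ
  have hconst : ∀ t, m t = m (2 * π - 4 * θ) := fun t =>
    PreconnectedSpace.constant inferInstance hmc
  have hlo : invariantCurve a b θ (2 * π - 4 * θ) = (0, -1) := by
    have := invariantCurve_beta h (j := 0) (by norm_num) (s := 0)
      ⟨le_rfl, by linarith [h.upper]⟩
    rw [arc_zero h.sin_beta_pos.ne', criticalOrbit_zero] at this
    simpa using this
  have hhi : invariantCurve a b θ (4 * (3 * π - 7 * θ)) = (0, 1) := by
    have := invariantCurve_alpha h (j := 4) (by norm_num) (s := 0)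
      ⟨le_rfl, by linarith [h.upper, pi_pos]⟩
    rw [arc_zero h.sin_alpha_pos.ne', criticalOrbit_eight h] at this
    simpa using this
  obtain ⟨k, hk⟩ := exists_int_of_circlePoint_eq_down (t := φ (2 * π - 4 * θ))
    (by rw [← hang, hlo]; simp [radialProj])
  obtain ⟨k', hk'⟩ := exists_int_of_circlePoint_eq_up (t := φ (4 * (3 * π - 7 * θ)))
    (by rw [← hang, hhi]; simp [radialProj])
  have hb1 : 0 < 2 * π - 4 * θ := by linarith [h.upper, pi_pos]
  have hb2 : 2 * π - 4 * θ < 4 * (3 * π - 7 * θ) := by linarith [h.upper, pi_pos]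
  have hb3 : 4 * (3 * π - 7 * θ) < 14 * π - 32 * θ := by linarith
  have half₁ := eq_add_half_of_cos_nonneg hφ hb2.le
    (hmono ⟨hb1.le, by linarith⟩ ⟨by linarith, hb3.le⟩ hb2) hk hk'
    fun s hs => cos_nonneg_of_angle (invariantCurve_fst_nonneg h hs.1 hs.2) (hang s)
  have hm1 := hm (2 * π - 4 * θ)
  -- Adding half a turn to the angle turns the left half-plane into the right one.
  have half₂ := eq_add_half_of_cos_nonneg (φ := fun s => φ s + 1 / 2) (c := 4 * (3 * π - 7 * θ))
    (d := 2 * π - 4 * θ + (14 * π - 32 * θ)) (k := k' + 1) (m := k + m (2 * π - 4 * θ))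
    (by fun_prop) (by linarith) ?_ ?_ ?_ ?_
  · rw [hm s, hconst s]
    linarith
  · have i1 := hmono ⟨by linarith, hb3.le⟩ ⟨by linarith, le_rfl⟩ hb3
    have i2 := hmono ⟨le_rfl, by linarith⟩ ⟨hb1.le, by linarith⟩ hb1
    have i3 := hm 0
    rw [hconst 0, zero_add] at i3
    linarith
  · push_cast; rw [hk']; ring
  · push_cast; rw [hm1, hk]; ring
  · intro s hs
    have e : 2 * π * (φ s + 1 / 2) = 2 * π * φ s + π := by ring
    rw [e, cos_add_pi]
    linarith [cos_nonpos_of_angle (invariantCurve_fst_nonpos h hs.1 hs.2) (hang s)]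

theorem strictMono_angle (h : IsResonant a b θ) {φ : ℝ → ℝ} (hφ : Continuous φ)
    (hang : ∀ s, radialProj (invariantCurve a b θ s) = circlePoint (φ s)) : StrictMono φ := by
  have hL := h.length_pos
  have hmono := strictMonoOn_angle h hφ hang
  have hper : ∀ (n : ℤ) s, φ (s + n * (14 * π - 32 * θ)) = φ s + n := by
    intro n s
    induction n using Int.induction_on with
    | zero => simp
    | succ n ih =>
      have e : s + ((n : ℤ) + 1 : ℤ) * (14 * π - 32 * θ) =
        s + (n : ℤ) * (14 * π - 32 * θ) + (14 * π - 32 * θ) := by push_cast; ring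
      rw [e, angle_add_length h hφ hang, ih]; push_cast; ring
    | pred n ih =>
      have e : s + (-(n : ℤ) : ℤ) * (14 * π - 32 * θ) =
        s + (-(n : ℤ) - 1 : ℤ) * (14 * π - 32 * θ) + (14 * π - 32 * θ) := by push_cast; ring
      rw [e, angle_add_length h hφ hang] at ih
      push_cast at ih ⊢; linarith
  have hfl : ∀ s, ∃ n : ℤ, n * (14 * π - 32 * θ) ≤ s ∧ s < (n + 1) * (14 * π - 32 * θ) :=
    fun s => ⟨⌊s / (14 * π - 32 * θ)⌋, (le_div_iff₀ hL).1 (Int.floor_le _),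
      (div_lt_iff₀ hL).1 (Int.lt_floor_add_one _)⟩
  intro s t hst
  obtain ⟨n, hn1, hn2⟩ := hfl s
  obtain ⟨m, hm1, hm2⟩ := hfl t
  have es := hper n (s - n * (14 * π - 32 * θ))
  have et := hper m (t - m * (14 * π - 32 * θ))
  rw [sub_add_cancel] at es et
  have hnm : n ≤ m := by
    by_contra! hlt
    have : (m : ℝ) + 1 ≤ n := by exact_mod_cast hlt
    nlinarith
  have e0 := hper 1 0
  simp only [Int.cast_one, zero_add, one_mul] at e0
  rcases hnm.eq_or_lt with rfl | hlt
  · have := hmono (a := s - n * (14 * π - 32 * θ)) (b := t - n * (14 * π - 32 * θ))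
      ⟨by linarith, by linarith⟩ ⟨by linarith, by linarith⟩ (by linarith)
    linarith
  · have : (n : ℝ) + 1 ≤ m := by exact_mod_cast hlt
    have i1 := hmono (a := s - n * (14 * π - 32 * θ)) (b := 14 * π - 32 * θ)
      ⟨by linarith, by linarith⟩ ⟨hL.le, le_rfl⟩ (by linarith)
    have i2 := hmono.monotoneOn (a := 0) (b := t - m * (14 * π - 32 * θ))
      ⟨le_rfl, hL.le⟩ ⟨by linarith, by linarith⟩ (by linarith)
    linarith

end angle

/-! ### Star-shaped closed curves -/

/-- `g` parametrises, with period one, a closed curve that winds once around the origin, and whose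
angle is the lift `Φ` of a circle homeomorphism. -/
structure IsStarCurve (g : ℝ → ℝ × ℝ) (Φ : CircleDeg1Liftˣ) : Prop where
  continuous : Continuous g
  periodic : Function.Periodic g 1
  ne_zero : ∀ x, g x ≠ 0
  angle : ∀ x, radialProj (g x) = circlePoint (Φ x)

namespace IsStarCurve

variable {g : ℝ → ℝ × ℝ} {Φ : CircleDeg1Liftˣ}

theorem exists_int_of_eq_smul (h : IsStarCurve g Φ) {x y c : ℝ} (hc : 0 < c)
    (hxy : g x = c • g y) : ∃ m : ℤ, x = y + m := by
  have h1 : circlePoint (Φ x) = circlePoint (Φ y) := by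
    rw [← h.angle, ← h.angle, hxy, radialProj_smul hc]
  obtain ⟨m, hm⟩ := (circlePoint_eq_iff _ _).1 h1
  refine ⟨m, (CircleDeg1Lift.toOrderIso Φ).injective ?_⟩
  simpa [CircleDeg1Lift.map_add_int] using hm

/-- Each ray from the origin meets the curve only once. -/
theorem eq_one_of_eq_smul (h : IsStarCurve g Φ) {x y c : ℝ} (hc : 0 < c)
    (hxy : g x = c • g y) : c = 1 := by
  obtain ⟨m, rfl⟩ := h.exists_int_of_eq_smul hc hxy
  have hp : g (y + m) = g y := by simpa using h.periodic.int_mul m y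
  rw [hp] at hxy
  have : (1 - c) • g y = 0 := by rw [sub_smul, one_smul, ← hxy, sub_self]
  rcases smul_eq_zero.1 this with h1 | h1
  · linarith
  · exact absurd h1 (h.ne_zero y)

theorem exists_eq_smul (h : IsStarCurve g Φ) {p : ℝ × ℝ} (hp : p ≠ 0) :
    ∃ c x : ℝ, 0 < c ∧ p = c • g x := by
  obtain ⟨t, ht⟩ := exists_circlePoint_eq_radialProj hp
  have hx : radialProj p = radialProj (g ((Φ⁻¹ : CircleDeg1Liftˣ) t)) := by
    rw [h.angle, CircleDeg1Lift.units_apply_inv_apply, ht]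
  have hg := euclidLength_pos (h.ne_zero ((Φ⁻¹ : CircleDeg1Liftˣ) t))
  refine ⟨euclidLength p * (euclidLength (g ((Φ⁻¹ : CircleDeg1Liftˣ) t)))⁻¹,
    (Φ⁻¹ : CircleDeg1Liftˣ) t,
    mul_pos (euclidLength_pos hp) (inv_pos.2 hg), ?_⟩
  rw [mul_smul, ← radialProj_eq_smul, ← hx, euclidLength_smul_radialProj hp]

theorem parametrizes (h : IsStarCurve g Φ) : ParametrizesClosedCurve g (Set.range g) := by
  refine ⟨h.continuous, h.periodic, ?_, rfl⟩
  intro x hx y hy hxy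
  obtain ⟨m, hm⟩ := h.exists_int_of_eq_smul (y := y) one_pos (by rw [hxy, one_smul])
  have h1 : (m : ℝ) < 1 := by linarith [hx.2, hy.1]
  have h2 : (-1 : ℝ) < m := by linarith [hx.1, hy.2]
  have h1' : m < 1 := by exact_mod_cast h1
  have h2' : -1 < m := by exact_mod_cast h2
  have h0 : m = 0 := by omega
  rw [hm, h0, Int.cast_zero, add_zero]

theorem range_eq_image (h : IsStarCurve g Φ) : Set.range g = g '' Set.Icc 0 1 := by
  simpa using (h.periodic.image_Icc one_pos 0).symm

/-- The region enclosed by a star-shaped curve. -/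
theorem isCompact_inner (h : IsStarCurve g Φ) :
    IsCompact ((fun q : ℝ × ℝ => q.1 • g q.2) '' (Set.Icc 0 1 ×ˢ Set.Icc 0 1)) :=
  (isCompact_Icc.prod isCompact_Icc).image
    (continuous_fst.smul (h.continuous.comp continuous_snd))

theorem exists_Icc (h : IsStarCurve g Φ) (x : ℝ) : ∃ y ∈ Set.Icc (0 : ℝ) 1, g y = g x := by
  have : g x ∈ g '' Set.Icc 0 1 := h.range_eq_image ▸ Set.mem_range_self x
  exact this

theorem isClosed_outer (h : IsStarCurve g Φ) :
    IsClosed {p | ∃ c x : ℝ, 1 ≤ c ∧ p = c • g x} := by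
  obtain ⟨x₀, -, hx₀⟩ := (isCompact_Icc (a := (0 : ℝ)) (b := 1)).exists_isMinOn
    (Set.nonempty_Icc.2 zero_le_one) (h.continuous.norm.continuousOn)
  have hd : 0 < ‖g x₀‖ := norm_pos_iff.2 (h.ne_zero x₀)
  have hmin : ∀ x, ‖g x₀‖ ≤ ‖g x‖ := by
    intro x
    obtain ⟨y, hy, hyx⟩ := h.exists_Icc x
    rw [← hyx]; exact hx₀ hy
  have hK : ∀ R : ℝ, IsCompact ((fun q : ℝ × ℝ => q.1 • g q.2) '' (Set.Icc 1 R ×ˢ Set.Icc 0 1)) :=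
    fun R => (isCompact_Icc.prod isCompact_Icc).image
      (continuous_fst.smul (h.continuous.comp continuous_snd))
  refine isClosed_of_closure_subset fun p hp => ?_
  -- The norm of g has a positive minimum, so within a ball the scale c is bounded and the region
  -- becomes part of a compact set.
  have hsub : {p | ∃ c x : ℝ, 1 ≤ c ∧ p = c • g x} ∩ Metric.ball 0 (‖p‖ + 1) ⊆
      (fun q : ℝ × ℝ => q.1 • g q.2) '' (Set.Icc 1 ((‖p‖ + 1) / ‖g x₀‖) ×ˢ Set.Icc 0 1) := by
    rintro _ ⟨⟨c, x, hc, rfl⟩, hball⟩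
    obtain ⟨y, hy, hyx⟩ := h.exists_Icc x
    refine ⟨(c, y), ⟨⟨hc, ?_⟩, hy⟩, by simp [hyx]⟩
    rw [mem_ball_zero_iff, norm_smul, Real.norm_of_nonneg (by linarith)] at hball
    rw [le_div_iff₀ hd]
    nlinarith [hmin x]
  have hp2 := closure_mono hsub
    (Metric.isOpen_ball.closure_inter ⟨hp, by rw [mem_ball_zero_iff]; linarith⟩)
  rw [(hK _).isClosed.closure_eq] at hp2
  obtain ⟨⟨c, y⟩, ⟨⟨hc, -⟩, -⟩, rfl⟩ := hp2
  exact ⟨c, y, hc, rfl⟩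

/-- The closed inner and outer regions cover the plane and meet only in the curve, so a connected
set that avoids the curve and contains 0 stays in the compact inner region. -/
theorem isBounded_component (h : IsStarCurve g Φ) :
    Bornology.IsBounded (connectedComponentIn (Set.range g)ᶜ (0 : ℝ × ℝ)) := by
  have h0 : (0 : ℝ × ℝ) ∈ (Set.range g)ᶜ := by
    rintro ⟨x, hx⟩; exact h.ne_zero x hx
  refine h.isCompact_inner.isBounded.subset fun p hp => ?_
  by_contra hpA
  have hK := isPreconnected_connectedComponentIn (F := (Set.range g)ᶜ) (x := (0 : ℝ × ℝ))
  have hsub := connectedComponentIn_subset (Set.range g)ᶜ (0 : ℝ × ℝ)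
  have hcover : ∀ q : ℝ × ℝ,
      q ∈ (fun q : ℝ × ℝ => q.1 • g q.2) '' (Set.Icc 0 1 ×ˢ Set.Icc 0 1) ∨
      q ∈ {p | ∃ c x : ℝ, 1 ≤ c ∧ p = c • g x} := by
    intro q
    by_cases hq : q = 0
    · left; exact ⟨(0, 0), by simp, by simp [hq]⟩
    · obtain ⟨c, x, hc, rfl⟩ := h.exists_eq_smul hq
      rcases le_total 1 c with h1 | h1
      · exact .inr ⟨c, x, h1, rfl⟩
      · obtain ⟨y, hy, hyx⟩ := h.exists_Icc x
        exact .inl ⟨(c, y), ⟨⟨hc.le, h1⟩, hy⟩, by simp [hyx]⟩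
  obtain ⟨q, hqK, ⟨⟨d, y⟩, ⟨⟨hd0, hd1⟩, -⟩, hq1⟩, ⟨c, x, hc, hq2⟩⟩ :=
    isPreconnected_closed_iff.1 hK _ _ h.isCompact_inner.isClosed h.isClosed_outer
      (fun q _ => hcover q)
      ⟨0, mem_connectedComponentIn h0, (0, 0), by simp, by simp⟩
      ⟨p, hp, (hcover p).resolve_left hpA⟩
  simp only at hq1 hd0 hd1
  have hc0 : 0 < c := by linarith
  have hd : 0 < d := by
    refine lt_of_le_of_ne hd0 ?_
    rintro rfl
    rw [zero_smul] at hq1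
    rw [← hq1] at hq2
    rcases smul_eq_zero.1 hq2.symm with h1 | h1
    · linarith
    · exact h.ne_zero x h1
  have e : g x = (c⁻¹ * d) • g y := by
    rw [mul_smul, hq1, hq2, smul_smul, inv_mul_cancel₀ hc0.ne', one_smul]
  have h1 := h.eq_one_of_eq_smul (by positivity) e
  have h2 : d = c := by field_simp at h1; exact h1
  have hc1 : c = 1 := by linarith
  exact hsub hqK ⟨x, by rw [hq2, hc1, one_smul]⟩

end IsStarCurve

/-! ### Dynamics on a curve on which the plane map acts as a translation -/

namespace IsStarCurve

variable {g : ℝ → ℝ × ℝ} {Φ : CircleDeg1Liftˣ} {a b r : ℝ}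

/-- By homogeneity T may be evaluated on the curve instead of the unit circle, where it is a
translation. The angle map Φ conjugates the two, so the translation number is r. -/
theorem isCircleLift (h : IsStarCurve g Φ) (hT : ∀ x, planeMap a b (g x) = g (x + r)) :
    IsCircleLift (rotationMap a b)
      (Φ * CircleDeg1Lift.translate (Multiplicative.ofAdd r) * Φ⁻¹ : CircleDeg1Liftˣ) := by
  refine ⟨(CircleDeg1Lift.toOrderIso
    (Φ * CircleDeg1Lift.translate (Multiplicative.ofAdd r) * Φ⁻¹)).continuous, fun t => ?_⟩
  have ht : circlePoint t = (euclidLength (g ((Φ⁻¹ : CircleDeg1Liftˣ) t)))⁻¹ •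
      g ((Φ⁻¹ : CircleDeg1Liftˣ) t) := by
    rw [← radialProj_eq_smul, h.angle, CircleDeg1Lift.units_apply_inv_apply]
  have hg := inv_pos.2 (euclidLength_pos (h.ne_zero ((Φ⁻¹ : CircleDeg1Liftˣ) t)))
  rw [rotationMap, ht, planeMap_smul hg.le, radialProj_smul hg, hT, h.angle, add_comm]
  rfl

theorem rotationNumber_eq (h : IsStarCurve g Φ) (hT : ∀ x, planeMap a b (g x) = g (x + r)) :
    rotationNumber (rotationMap a b) = Int.fract r := by
  rw [_root_.rotationNumber_eq (h.isCircleLift hT), Units.val_mul, Units.val_mul,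
    CircleDeg1Lift.translationNumber_conj_eq, CircleDeg1Lift.translationNumber_translate]

theorem isInvariantCircle (h : IsStarCurve g Φ) (hT : ∀ x, planeMap a b (g x) = g (x + r)) :
    IsInvariantCircle (planeMap a b) (Set.range g) := by
  refine ⟨⟨g, h.parametrizes⟩, ?_, h.isBounded_component, ?_⟩
  · rintro ⟨x, hx⟩
    exact h.ne_zero x hx
  · ext p
    constructor
    · rintro ⟨_, ⟨x, rfl⟩, rfl⟩
      exact ⟨x + r, (hT x).symm⟩
    · rintro ⟨x, rfl⟩
      exact ⟨g (x - r), ⟨_, rfl⟩, by rw [hT, sub_add_cancel]⟩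

theorem isPeriodicMap (h : IsStarCurve g Φ) (hT : ∀ x, planeMap a b (g x) = g (x + r))
    (hr : ¬ Irrational r) : IsPeriodicMap (planeMap a b) := by
  rw [Irrational, not_not] at hr
  obtain ⟨q, rfl⟩ := hr
  have hit : ∀ (n : ℕ) (c x : ℝ), 0 ≤ c →
      (planeMap a b)^[n] (c • g x) = c • g (x + n * (q : ℝ)) := by
    intro n c x hc
    induction n with
    | zero => simp
    | succ n ih =>
      rw [Function.iterate_succ_apply', ih, planeMap_smul hc, hT]
      congr 2; push_cast; ring
  -- After `q.den` steps the parameter moves by the integer `q.num`, a period of g; scaling then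
  -- covers the whole plane.
  refine ⟨q.den, q.pos, funext fun p => ?_⟩
  by_cases hp : p = 0
  · rw [hp, id, Function.iterate_fixed (planeMap_zero a b)]
  · obtain ⟨c, x, hc, rfl⟩ := h.exists_eq_smul hp
    have hq : (q.den : ℝ) * (q : ℝ) = q.num := by exact_mod_cast Rat.den_mul_eq_num q
    have hper : g (x + q.num) = g x := by simpa using h.periodic.int_mul q.num x
    rw [hit _ _ _ hc.le, hq, hper, id]

end IsStarCurve

/-! ### Resonant parameters -/

namespace IsResonant

variable {a b θ : ℝ}

theorem exists_isStarCurve (h : IsResonant a b θ) :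
    ∃ Φ, IsStarCurve (fun x => invariantCurve a b θ ((14 * π - 32 * θ) * x)) Φ := by
  obtain ⟨φ, hφ, hang⟩ := exists_continuous_angle (continuous_invariantCurve h)
    (invariantCurve_ne_zero h)
  have hL := h.length_pos
  have hmono := strictMono_angle h hφ hang
  set f : CircleDeg1Lift :=
    { toFun := fun x => φ ((14 * π - 32 * θ) * x)
      monotone' := fun x y hxy => hmono.monotone (mul_le_mul_of_nonneg_left hxy hL.le)
      map_add_one' := fun x => by rw [mul_add, mul_one, angle_add_length h hφ hang] } with hf
  have hfx : ∀ x, f x = φ ((14 * π - 32 * θ) * x) := fun _ => rfl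
  have hfc : Continuous f := hφ.comp (continuous_const.mul continuous_id)
  have hinj : Function.Injective f := fun x y hxy =>
    mul_left_cancel₀ hL.ne' (hmono.injective hxy)
  obtain ⟨Φ, hΦ⟩ := CircleDeg1Lift.isUnit_iff_bijective.2
    ⟨hinj, f.continuous_iff_surjective.1 hfc⟩
  refine ⟨Φ, (continuous_invariantCurve h).comp (by fun_prop), fun x => ?_,
    fun x => invariantCurve_ne_zero h _, fun x => ?_⟩
  · simp only [mul_add, mul_one, invariantCurve_add_length h]
  · rw [hang, hΦ, hfx]

theorem planeMap_invariantCurve (h : IsResonant a b θ) (x : ℝ) :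
    planeMap a b (invariantCurve a b θ ((14 * π - 32 * θ) * x)) =
      invariantCurve a b θ
        ((14 * π - 32 * θ) * (x + (3 * π - 7 * θ) / (14 * π - 32 * θ))) := by
  rw [mul_add, mul_div_cancel₀ _ h.length_pos.ne', invariantCurve_add_step h]

theorem rotationNumber_eq (h : IsResonant a b θ) :
    rotationNumber (rotationMap a b) = (3 * π - 7 * θ) / (14 * π - 32 * θ) := by
  obtain ⟨Φ, hΦ⟩ := h.exists_isStarCurve
  rw [hΦ.rotationNumber_eq h.planeMap_invariantCurve, Int.fract_eq_self]
  refine ⟨div_nonneg h.step_pos.le h.length_pos.le, (div_lt_one h.length_pos).2 ?_⟩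
  linarith [h.upper, pi_pos]

theorem not_irrational_iff (h : IsResonant a b θ) :
    ¬ Irrational (rotationNumber (rotationMap a b)) ↔ ∃ q : ℚ, θ = q * π := by
  have hL := h.length_pos
  rw [h.rotationNumber_eq, Irrational, not_not]
  constructor
  · rintro ⟨r, hr⟩
    rw [eq_div_iff hL.ne'] at hr
    have h1 : (32 * (r : ℝ) - 7) * θ = (14 * r - 3) * π := by linarith
    have h2 : 32 * (r : ℝ) - 7 ≠ 0 := by
      -- The value r = 7/32 would force 14 r − 3 = 0, whereas it is 1/16.
      intro h0
      rw [h0, zero_mul] at h1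
      rcases mul_eq_zero.1 h1.symm with h3 | h3
      · linarith
      · exact pi_ne_zero h3
    refine ⟨(14 * r - 3) / (32 * r - 7), ?_⟩
    push_cast
    rw [div_mul_eq_mul_div, eq_div_iff h2]
    linarith
  · rintro ⟨q, rfl⟩
    refine ⟨(3 - 7 * q) / (14 - 32 * q), ?_⟩
    have e : 14 * π - 32 * (q * π) = (14 - 32 * q) * π := by ring
    have h0 : (14 - 32 * (q : ℝ)) ≠ 0 := by
      intro h0
      rw [e, h0, zero_mul] at hL
      exact hL.false
    have hπ := pi_ne_zero
    rw [e]
    push_cast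
    field_simp

theorem isPeriodicMap (h : IsResonant a b θ)
    (hr : ¬ Irrational (rotationNumber (rotationMap a b))) : IsPeriodicMap (planeMap a b) := by
  obtain ⟨Φ, hΦ⟩ := h.exists_isStarCurve
  rw [h.rotationNumber_eq] at hr
  exact hΦ.isPeriodicMap h.planeMap_invariantCurve hr

/-! ### The eight elliptic arcs of the invariant curve -/

theorem exists_ellipse_alpha (h : IsResonant a b θ) {j : ℕ} (hj : j ≤ 4) :
    ∃ E, IsCentredEllipse E ∧ ∀ s, j * (3 * π - 7 * θ) ≤ s →
      s ≤ j * (3 * π - 7 * θ) + (2 * π - 4 * θ) → invariantCurve a b θ s ∈ E := by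
  obtain ⟨E, hE, hmem⟩ := exists_isCentredEllipse_arc h.sin_alpha_pos
    (wedge_criticalOrbit_four h (j := j) (by omega)).ne'
  refine ⟨E, hE, fun s hs1 hs2 => ?_⟩
  rw [← sub_add_cancel s (j * (3 * π - 7 * θ)),
    invariantCurve_alpha h (by omega) ⟨by linarith, by linarith⟩]
  exact hmem _

theorem exists_ellipse_beta (h : IsResonant a b θ) {j : ℕ} (hj : j ≤ 4) :
    ∃ E, IsCentredEllipse E ∧ ∀ s, j * (3 * π - 7 * θ) + (2 * π - 4 * θ) ≤ s →
      s ≤ (j + 1) * (3 * π - 7 * θ) → invariantCurve a b θ s ∈ E := by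
  obtain ⟨E, hE, hmem⟩ := exists_isCentredEllipse_arc h.sin_beta_pos
    (wedge_criticalOrbit_five h hj).ne'
  refine ⟨E, hE, fun s hs1 hs2 => ?_⟩
  have e : s = s - j * (3 * π - 7 * θ) - (2 * π - 4 * θ) + (2 * π - 4 * θ) +
      j * (3 * π - 7 * θ) := by ring
  rw [e, invariantCurve_beta h hj ⟨by linarith, by linarith⟩]
  exact hmem _

/-- The α- and β-parts with j = 0 lie on the same ellipse, which reduces the nine arcs to eight. -/
theorem exists_ellipse_first (h : IsResonant a b θ) :
    ∃ E, IsCentredEllipse E ∧ ∀ s, 0 ≤ s → s ≤ 3 * π - 7 * θ → invariantCurve a b θ s ∈ E := by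
  refine ⟨_, ellipsePoint_isCentredEllipse h, fun s hs1 hs2 => ?_⟩
  rw [invariantCurve_eq_ellipsePoint h ⟨hs1, hs2⟩]
  exact ellipsePoint_mem h _

/-- The parameters at which the invariant curve passes from one ellipse to the next. -/
noncomputable def breakpoint (θ : ℝ) : Fin 9 → ℝ :=
  ![0, 3 * π - 7 * θ, (3 * π - 7 * θ) + (2 * π - 4 * θ), 2 * (3 * π - 7 * θ),
    2 * (3 * π - 7 * θ) + (2 * π - 4 * θ), 3 * (3 * π - 7 * θ),
    3 * (3 * π - 7 * θ) + (2 * π - 4 * θ), 4 * (3 * π - 7 * θ), 14 * π - 32 * θ]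

theorem strictMono_breakpoint (h : IsResonant a b θ) : StrictMono (breakpoint θ) := by
  have h1 := h.step_pos
  have h2 := h.upper
  have h3 := pi_pos
  rw [Fin.strictMono_iff_lt_succ]
  intro i
  fin_cases i <;> simp [breakpoint] <;> linarith

theorem exists_ellipse (h : IsResonant a b θ) (i : Fin 8) :
    ∃ E, IsCentredEllipse E ∧ ∀ s, breakpoint θ i.castSucc ≤ s → s ≤ breakpoint θ i.succ →
      invariantCurve a b θ s ∈ E := by
  have of_le : ∀ {x y x' y' : ℝ}, x' = x → y' = y →
      (∃ E, IsCentredEllipse E ∧ ∀ s, x ≤ s → s ≤ y → invariantCurve a b θ s ∈ E) →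
      ∃ E, IsCentredEllipse E ∧ ∀ s, x' ≤ s → s ≤ y' → invariantCurve a b θ s ∈ E := by
    rintro x y _ _ rfl rfl hE; exact hE
  fin_cases i
  · exact h.exists_ellipse_first
  · exact of_le (by simp [breakpoint]) (by simp [breakpoint])
      (h.exists_ellipse_alpha (j := 1) (by norm_num))
  · exact of_le (by simp [breakpoint]) (by change 2 * (3 * π - 7 * θ) = _; push_cast; ring)
      (h.exists_ellipse_beta (j := 1) (by norm_num))
  · exact of_le (by simp [breakpoint]) (by simp [breakpoint])
      (h.exists_ellipse_alpha (j := 2) (by norm_num))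
  · exact of_le (by simp [breakpoint]) (by change 3 * (3 * π - 7 * θ) = _; push_cast; ring)
      (h.exists_ellipse_beta (j := 2) (by norm_num))
  · exact of_le (by simp [breakpoint]) (by simp [breakpoint])
      (h.exists_ellipse_alpha (j := 3) (by norm_num))
  · exact of_le (by simp [breakpoint]) (by change 4 * (3 * π - 7 * θ) = _; push_cast; ring)
      (h.exists_ellipse_beta (j := 3) (by norm_num))
  · exact of_le (by simp [breakpoint]) (by simp [breakpoint]; ring)
      (h.exists_ellipse_alpha (j := 4) (by norm_num))

theorem exists_isInvariantCircle (h : IsResonant a b θ) :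
    ∃ C, IsInvariantCircle (planeMap a b) C ∧ IsPiecewiseElliptic 8 C := by
  obtain ⟨Φ, hΦ⟩ := h.exists_isStarCurve
  have hL := h.length_pos
  refine ⟨_, hΦ.isInvariantCircle h.planeMap_invariantCurve, _,
    fun i => breakpoint θ i / (14 * π - 32 * θ), hΦ.parametrizes,
    fun i j hij => div_lt_div_of_pos_right (h.strictMono_breakpoint hij) hL, ?_, ?_, fun i => ?_⟩
  · simp [breakpoint]
  · exact div_self hL.ne'
  · obtain ⟨E, hE, hmem⟩ := h.exists_ellipse i
    refine ⟨E, hE, ?_⟩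
    rintro _ ⟨x, ⟨hx1, hx2⟩, rfl⟩
    exact hmem _ ((div_le_iff₀' hL).1 hx1) ((le_div_iff₀' hL).1 hx2)

theorem of_arccos (h1 : 1 < a) (h2 : a < √2) (hb : b = 2 * (a ^ 2 - 1) / (a * (a ^ 2 - 2))) :
    IsResonant a b (arccos (a / 2)) := by
  have hs : √2 ^ 2 = 2 := sq_sqrt zero_le_two
  have ha2 : a ^ 2 < 2 := by nlinarith
  have hs2 : √2 < 2 := by nlinarith [sqrt_nonneg 2]
  refine ⟨?_, ?_, ?_, ?_⟩
  · have : arccos (√2 / 2) < arccos (a / 2) :=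
      arccos_lt_arccos (by linarith) (by linarith) (by linarith)
    rwa [← cos_pi_div_four, arccos_cos (by linarith [pi_pos]) (by linarith [pi_pos])] at this
  · have : arccos (a / 2) < arccos (1 / 2) :=
      arccos_lt_arccos (by linarith) (by linarith) (by linarith)
    rwa [← cos_pi_div_three, arccos_cos (by linarith [pi_pos]) (by linarith [pi_pos])] at this
  · rw [cos_arccos (by linarith) (by linarith)]; ring
  · have : a * (a ^ 2 - 2) ≠ 0 := mul_ne_zero (by linarith) (by linarith)
    rw [hb, div_mul_cancel₀ _ this]

end IsResonant

/-! ### Irrationality for the special parameter -/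

/-- The conjugate `2 + 2 √2` of `2 - 2 √2` exceeds one, so `2 - 2 √2` is not the cosine of a
rational angle. -/
theorem not_rational_angle_of_cos_eq {ψ : ℝ} (hψ : cos ψ = 2 - 2 * √2) (q : ℚ) :
    ψ ≠ q * (2 * π) := by
  have hs : √2 * √2 = 2 := mul_self_sqrt zero_le_two
  have hs1 : 1 ≤ √2 := by rw [one_le_sqrt]; norm_num
  -- The numbers 2 cos (n ψ) lie in ℤ[√2] and satisfy a recurrence with multiplier 4 − 4√2. Their
  -- conjugates satisfy it with multiplier 4 + 4√2 > 2, hence increase strictly from 2.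
  have key : ∀ n : ℕ, ∃ k l k' l' : ℤ, 2 * cos (n * ψ) = k + l * √2 ∧
      2 * cos ((n + 1) * ψ) = k' + l' * √2 ∧ 2 ≤ k - l * √2 ∧ k - l * √2 < k' - l' * √2 := by
    intro n
    induction n with
    | zero =>
      refine ⟨2, 0, 4, -4, by simp, ?_, by simp, ?_⟩
      · push_cast; rw [zero_add, one_mul, hψ]; ring
      · push_cast; linarith
    | succ n ih =>
      obtain ⟨k, l, k', l', h1, h2, h3, h4⟩ := ih
      -- These are the coordinates of (4 − 4√2)(k' + l'√2) − (k + l√2).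
      refine ⟨k', l', 4 * k' - 8 * l' - k, 4 * l' - 4 * k' - l, by exact_mod_cast h2, ?_,
        by linarith, ?_⟩
      · have e1 : ((n + 1 : ℕ) + 1 : ℝ) * ψ = (n + 1) * ψ + ψ := by push_cast; ring
        have e2 : (n : ℝ) * ψ = (n + 1) * ψ - ψ := by ring
        rw [e2, cos_sub] at h1
        rw [e1, cos_add]
        push_cast
        rw [hψ] at h1 ⊢
        linear_combination (4 - 4 * √2) * h2 - h1 - 4 * l' * hs
      · push_cast
        have e : (4 * k' - 8 * l' - k : ℝ) - (4 * l' - 4 * k' - l) * √2 =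
            (4 + 4 * √2) * (k' - l' * √2) - (k - l * √2) := by
          linear_combination 4 * l' * hs
        rw [e]
        nlinarith
  intro hq
  obtain ⟨n, hn⟩ : ∃ n, q.den = n + 1 := ⟨q.den - 1, by have := q.pos; omega⟩
  obtain ⟨k, l, k', l', -, h2, h3, h4⟩ := key n
  have e : ((n : ℝ) + 1) * ψ = q.num * (2 * π) := by
    have hd : (q.den : ℝ) * (q : ℝ) = q.num := by exact_mod_cast Rat.den_mul_eq_num q
    rw [hq, ← hd, hn]; push_cast; ring
  rw [e, cos_int_mul_two_pi] at h2
  -- After `q.den` steps the value is 2, so by irrationality of √2 its conjugate is also 2, against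
  -- the strict growth.
  have hl : l' = 0 := by
    by_contra hl
    refine irrational_sqrt_two ⟨(2 - k') / l', ?_⟩
    have : (l' : ℝ) ≠ 0 := by exact_mod_cast hl
    push_cast
    field_simp
    linarith
  subst hl
  simp at h2 h4
  linarith

end InvariantCircle

/-! ### Both parts of the theorem, with the special parameter a = 2^{1/4} -/

theorem mainTheorem4 :
    (∀ a b : ℝ, 1 < a → a < Real.sqrt 2 → b = 2 * (a ^ 2 - 1) / (a * (a ^ 2 - 2)) →
      b < 0 ∧
      (planeMap a b)^[8] (0, -1) = (0, 1) ∧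
      (∃ θ : ℝ, Real.pi / 4 < θ ∧ θ < Real.pi / 3 ∧ a = 2 * Real.cos θ ∧
        rotationNumber (rotationMap a b) =
          (3 * Real.pi - 7 * θ) / (14 * Real.pi - 32 * θ) ∧
        (¬ Irrational (rotationNumber (rotationMap a b)) ↔ ∃ q : ℚ, θ = q * Real.pi)) ∧
      (¬ Irrational (rotationNumber (rotationMap a b)) → IsPeriodicMap (planeMap a b)) ∧
      (Irrational (rotationNumber (rotationMap a b)) →
        ∃ C : Set (ℝ × ℝ), IsInvariantCircle (planeMap a b) C ∧
          ∃ n : ℕ, n ≤ 8 ∧ IsPiecewiseElliptic n C)) ∧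
    (∀ a b : ℝ, a = (2 : ℝ) ^ ((1 : ℝ) / 4) → b = -a →
      Irrational (rotationNumber (rotationMap a b)) ∧
      ∃ C : Set (ℝ × ℝ), IsInvariantCircle (planeMap a b) C ∧ IsPiecewiseElliptic 8 C) := by
  constructor
  · intro a b h1 h2 hb
    have h := IsResonant.of_arccos h1 h2 hb
    exact ⟨h.b_neg, criticalOrbit_eight h,
      ⟨_, h.lower, h.upper, h.a_eq, h.rotationNumber_eq, h.not_irrational_iff⟩,
      h.isPeriodicMap, fun _ =>
        let ⟨C, hC, hE⟩ := h.exists_isInvariantCircle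
        ⟨C, hC, 8, le_rfl, hE⟩⟩
  · rintro a b ha rfl
    have ha0 : 0 < a := by rw [ha]; positivity
    have hs : Real.sqrt 2 ^ 2 = 2 := Real.sq_sqrt zero_le_two
    have hs0 : 0 ≤ Real.sqrt 2 := Real.sqrt_nonneg 2
    have ha2 : a ^ 2 = Real.sqrt 2 := by
      rw [ha, ← Real.rpow_natCast, ← Real.rpow_mul zero_le_two, Real.sqrt_eq_rpow]
      norm_num
    have hs1 : 1 < Real.sqrt 2 := by nlinarith
    have h1 : 1 < a := by nlinarith
    have h2 : a < Real.sqrt 2 := by nlinarith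
    have hb : -a = 2 * (a ^ 2 - 1) / (a * (a ^ 2 - 2)) := by
      have hne : a * (a ^ 2 - 2) ≠ 0 := mul_ne_zero ha0.ne' (by nlinarith)
      rw [eq_div_iff hne]
      have : -a * (a * (a ^ 2 - 2)) = -a ^ 2 * (a ^ 2 - 2) := by ring
      rw [this, ha2]
      linear_combination (-1) * hs
    have h := IsResonant.of_arccos h1 h2 hb
    refine ⟨?_, h.exists_isInvariantCircle⟩
    by_contra hr
    obtain ⟨q, hq⟩ := h.not_irrational_iff.1 hr
    -- Since cos² θ = a²/4 = √2/4, doubling the angle twice gives cos 4θ = 2 − 2√2.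
    have hcos : Real.cos (2 * (2 * Real.arccos (a / 2))) = 2 - 2 * Real.sqrt 2 := by
      have hc : Real.cos (Real.arccos (a / 2)) ^ 2 = Real.sqrt 2 / 4 := by
        rw [← ha2]; linarith [congrArg (· ^ 2) h.a_eq]
      rw [Real.cos_two_mul, Real.cos_two_mul, hc]
      linear_combination hs / 2
    refine not_rational_angle_of_cos_eq hcos (2 * q) ?_
    rw [hq]; push_cast; ring
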